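/- **Setting.** Let $k\ge 0$, $\varepsilon\in(0,1]$, $\beta,\sigma>0$, let $N\ge 4$ be divisible by $4$, and put $\tau=\min\{\sigma\sqrt{\varepsilon}\,\beta^{-1}\ln N,\ 1/4\}$. The Shishkin mesh on $\Omega=(0,1)^2$ has mesh points $(x_i,y_j)$, $0\le i,j\le N$, where $x_i=y_i=4\tau i/N$ for $0\le i\le N/4$, $x_i=y_i=\tau+2(1-2\tau)(i/N-1/4)$ for $N/4<i\le 3N/4$, and $x_i=y_i=1-4\tau(1-i/N)$ for $3N/4<i\le N$. For $1\le i,j\le N$ set $h_i=x_i-x_{i-1}=y_i-y_{i-1}$, $I_i=(x_{i-1},x_i)$, $J_j=(y_{j-1},y_j)$ and $K_{ij}=I_i\times J_j$. Let $\mathcal V_N=\{v\in L^2(\Omega): v|_{K_{ij}}\in\mathcal P^k(I_i)\otimes\mathcal P^k(J_j)\ \text{for all } i,j\}$, where $\mathcal P^k$ denotes polynomials of degree at most $k$ and $\mathcal P^{-1}=\{0\}$. Write $w^\pm_{i,y}=\lim_{x\to x_i^\pm}w(x,y)$, $[\![w]\!]_{i,y}=w^+_{i,y}-w^-_{i,y}$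 and $\{\!\{w\}\!\}_{i,y}=\frac12(w^+_{i,y}+w^-_{i,y})$ on the interior vertical edges $x=x_i$, and define $w^{\pm}_{x,j}$, $[\![w]\!]_{x,j}$, $\{\!\{w\}\!\}_{x,j}$ in the same way on the interior horizontal edges $y=y_j$. Let $\|\cdot\|_D$ be the $L^2(D)$ norm. On an interval $(a,b)$ let $\pi$ be the $L^2$-projector onto $\mathcal P^k$, and for $g\in C([a,b])$ let $\pi^{+}g,\pi^-g\in\mathcal P^k$ be the Gauss–Radau projections, determined by $\int_a^b(\pi^\pm g-g)q=0$ for all $q\in\mathcal P^{k-1}$ together with $(\pi^+g)(a)=g(a)$ and $(\pi^-g)(b)=g(b)$ respectively. On each $K_{ij}$ set $\Pi_x^\pm=\pi^\pm_x\otimes\pi_y$ and $\Pi_y^\pm=\pi_x\otimes\pi^\pm_y$, the subscript being the variable in which the one-dimensional projector acts. **Lemma.** For each $k\ge0$ there is a constant $C>0$ depending only on $k$ (in particular not on $\varepsilon,\beta,\sigma,N,i,j,z,v$) such that the following holds for every mesh as above. (a) Let $1\le i\le N-1$ and $1\le j\le N$ with $h_i=h_{i+1}$, and let $z\in C^{k+1}(\overline{K_{ij}}\cup\overline{K_{i+1,j}})$.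 Then for all $v\in\mathcal V_N$ and for each choice of sign $$\left|\int_{J_j}\{\!\{z-\Pi_y^{\pm}z\}\!\}_{i,y}\,[\![v]\!]_{i,y}\,dy\right|\le C h_i^{-1}\Big[h_i^{k+1}\|\partial_x^{k+1}z\|_{K_{ij}\cup K_{i+1,j}}+h_j^{k+1}\|\partial_y^{k+1}z\|_{K_{ij}\cup K_{i+1,j}}\Big]\|v\|_{K_{ij}\cup K_{i+1,j}}.$$ (b) Let $1\le i\le N$ and $1\le j\le N-1$ with $h_j=h_{j+1}$, and let $z\in C^{k+1}(\overline{K_{ij}}\cup\overline{K_{i,j+1}})$. Then for all $v\in\mathcal V_N$ and for each choice of sign $$\left|\int_{I_i}\{\!\{z-\Pi_x^{\pm}z\}\!\}_{x,j}\,[\![v]\!]_{x,j}\,dx\right|\le C h_j^{-1}\Big[h_i^{k+1}\|\partial_x^{k+1}z\|_{K_{ij}\cup K_{i,j+1}}+h_j^{k+1}\|\partial_y^{k+1}z\|_{K_{ij}\cup K_{i,j+1}}\Big]\|v\|_{K_{ij}\cup K_{i,j+1}}.$$ -/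

import Mathlib

open MeasureTheory Set Filter Topology Polynomial

noncomputable section

namespace LDG

/-! ## One-dimensional projectors

`Polynomial.degreeLT ℝ n` is the space of real polynomials of degree less than `n`, so
`P^k` is `degreeLT ℝ (k + 1)` and `P^{k-1}` is `degreeLT ℝ k` (which is `{0}` for `k = 0`). -/

/-- `p` is the `L²(a, b)`-projection of `f` onto the polynomials of degree at most `k`. -/
def IsL2Proj (k : ℕ) (a b : ℝ) (f : ℝ → ℝ) (p : ℝ[X]) : Prop :=
  p ∈ degreeLT ℝ (k + 1) ∧
    ∀ v ∈ degreeLT ℝ (k + 1),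
      ∫ x in a..b, p.eval x * v.eval x = ∫ x in a..b, f x * v.eval x

/-- `p` is the Gauss-Radau projection of `f` on `(a, b)`, of degree at most `k`, that
interpolates `f` at the point `e` (used with `e = a` and with `e = b`). -/
def IsRadauProj (k : ℕ) (a b e : ℝ) (f : ℝ → ℝ) (p : ℝ[X]) : Prop :=
  p ∈ degreeLT ℝ (k + 1) ∧
    (∀ v ∈ degreeLT ℝ k,
      ∫ x in a..b, p.eval x * v.eval x = ∫ x in a..b, f x * v.eval x) ∧
    p.eval e = f e

theorem poly_eq_zero_of_integral {a b : ℝ} (hab : a < b) (r : ℝ[X])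
    (hr : ∀ x ∈ Icc a b, 0 ≤ r.eval x) (h0 : ∫ x in a..b, r.eval x = 0) : r = 0 := by
  by_contra hne
  have hfin : {x | r.IsRoot x}.Finite := finite_setOfPred_isRoot hne
  obtain ⟨c, hc, hc'⟩ := ((Icc_infinite hab).sdiff hfin).nonempty
  have hpos : 0 < r.eval c := lt_of_le_of_ne (hr c hc) (fun h => hc' h.symm)
  have := intervalIntegral.integral_pos hab r.continuous.continuousOn
    (fun x hx => hr x ⟨hx.1.le, hx.2⟩) ⟨c, hc, hpos⟩
  linarith

/-- The functional `v ↦ ∫ f v` on the polynomials of degree less than `n`. -/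
def moment (n : ℕ) (a b : ℝ) (f : ℝ → ℝ) (hf : IntervalIntegrable f volume a b) :
    Module.Dual ℝ (degreeLT ℝ n) where
  toFun v := ∫ x in a..b, f x * (v : ℝ[X]).eval x
  map_add' v w := by
    have h (u : ℝ[X]) : IntervalIntegrable (fun x => f x * u.eval x) volume a b :=
      hf.mul_continuousOn u.continuous.continuousOn
    simp only [Submodule.coe_add, eval_add, mul_add]
    exact intervalIntegral.integral_add (h _) (h _)
  map_smul' c v := by
    simp only [SetLike.val_smul, eval_smul, smul_eq_mul, RingHom.id_apply]
    rw [← intervalIntegral.integral_const_mul]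
    congr 1; ext x; ring

theorem poly_intervalIntegrable (p : ℝ[X]) (a b : ℝ) :
    IntervalIntegrable (fun x => p.eval x) volume a b :=
  p.continuous.intervalIntegrable a b

/-- The map sending a polynomial of degree less than `m` to its moments against the
polynomials of degree less than `n`. -/
def momentMap (m n : ℕ) (a b : ℝ) :
    degreeLT ℝ m →ₗ[ℝ] Module.Dual ℝ (degreeLT ℝ n) where
  toFun p := moment n a b (fun x => (p : ℝ[X]).eval x) (poly_intervalIntegrable _ a b)
  map_add' p q := by
    ext v
    have h (u : ℝ[X]) : IntervalIntegrable
        (fun x => u.eval x * (v : ℝ[X]).eval x) volume a b :=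
      (poly_intervalIntegrable u a b).mul_continuousOn (v : ℝ[X]).continuous.continuousOn
    simp only [moment, Submodule.coe_add, eval_add, add_mul, LinearMap.coe_mk, AddHom.coe_mk,
      LinearMap.add_apply]
    exact intervalIntegral.integral_add (h _) (h _)
  map_smul' c p := by
    ext v
    simp only [moment, SetLike.val_smul, eval_smul, smul_eq_mul, RingHom.id_apply,
      LinearMap.coe_mk, AddHom.coe_mk, LinearMap.smul_apply]
    rw [← intervalIntegral.integral_const_mul]
    congr 1; ext x; ring

theorem finrank_degreeLT (n : ℕ) : Module.finrank ℝ (degreeLT ℝ n) = n := by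
  rw [(degreeLTEquiv ℝ n).finrank_eq]; simp

instance finiteDimensional_degreeLT (n : ℕ) : FiniteDimensional ℝ (degreeLT ℝ n) :=
  Module.Finite.equiv (degreeLTEquiv ℝ n).symm

theorem isL2Proj_hom_zero {k : ℕ} {a b : ℝ} (hab : a < b) {d : ℝ[X]}
    (hd : d ∈ degreeLT ℝ (k + 1))
    (h : ∀ v ∈ degreeLT ℝ (k + 1), ∫ x in a..b, d.eval x * v.eval x = 0) : d = 0 := by
  have h2 : d * d = 0 := by
    apply poly_eq_zero_of_integral hab
    · intro x _; rw [eval_mul]; exact mul_self_nonneg _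
    · simpa using h d hd
  exact mul_self_eq_zero.mp h2

theorem isRadauProj_hom_zero {k : ℕ} {a b e : ℝ} (hab : a < b) (he : e = a ∨ e = b)
    {d : ℝ[X]} (hd : d ∈ degreeLT ℝ (k + 1))
    (h : ∀ v ∈ degreeLT ℝ k, ∫ x in a..b, d.eval x * v.eval x = 0)
    (hde : d.eval e = 0) : d = 0 := by
  obtain ⟨q, rfl⟩ := dvd_iff_isRoot.mpr hde
  by_cases hq0 : q = 0
  · simp [hq0]
  have hq : q ∈ degreeLT ℝ k := by
    rw [mem_degreeLT, degree_mul, degree_X_sub_C, degree_eq_natDegree hq0] at hd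
    rw [mem_degreeLT, degree_eq_natDegree hq0]
    have : 1 + q.natDegree < k + 1 := by exact_mod_cast hd
    exact_mod_cast (by omega : q.natDegree < k)
  have h1 := h q hq
  exfalso
  rcases he with rfl | rfl
  · have h2 : (X - C e) * (q * q) = 0 := by
      apply poly_eq_zero_of_integral hab
      · intro x hx
        simp only [eval_mul, eval_sub, eval_X, eval_C]
        exact mul_nonneg (by linarith [hx.1]) (mul_self_nonneg _)
      · rw [← h1]; congr 1; ext x; simp only [eval_mul]; ring
    rcases mul_eq_zero.mp h2 with h3 | h3
    · exact X_sub_C_ne_zero e h3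
    · exact hq0 (mul_self_eq_zero.mp h3)
  · have h2 : (C e - X) * (q * q) = 0 := by
      apply poly_eq_zero_of_integral hab
      · intro x hx
        simp only [eval_mul, eval_sub, eval_X, eval_C]
        exact mul_nonneg (by linarith [hx.2]) (mul_self_nonneg _)
      · rw [← neg_eq_zero, ← intervalIntegral.integral_neg, ← h1]
        congr 1; ext x; simp only [eval_mul, eval_sub, eval_X, eval_C]; ring
    rcases mul_eq_zero.mp h2 with h3 | h3
    · exact X_sub_C_ne_zero e (by rw [← neg_sub, h3, neg_zero])
    · exact hq0 (mul_self_eq_zero.mp h3)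

/-- The `L²`-projection of an integrable function exists and is unique. -/
theorem existsUnique_isL2Proj (k : ℕ) {a b : ℝ} (hab : a < b) (f : ℝ → ℝ)
    (hf : IntervalIntegrable f volume a b) : ∃! p, IsL2Proj k a b f p := by
  have hinj : Function.Injective (momentMap (k + 1) (k + 1) a b) := by
    rw [← LinearMap.ker_eq_bot, LinearMap.ker_eq_bot']
    intro d hd
    have := isL2Proj_hom_zero hab d.2 (fun v hv => by
      simpa [momentMap, moment] using LinearMap.congr_fun hd ⟨v, hv⟩)
    exact Subtype.ext this
  have hsurj : Function.Surjective (momentMap (k + 1) (k + 1) a b) :=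
    (LinearMap.injective_iff_surjective_of_finrank_eq_finrank
      (Subspace.dual_finrank_eq).symm).mp hinj
  obtain ⟨p, hp⟩ := hsurj (moment (k + 1) a b f hf)
  have hp' : IsL2Proj k a b f p := ⟨p.2, fun v hv => by
    simpa [momentMap, moment] using LinearMap.congr_fun hp ⟨v, hv⟩⟩
  refine ⟨p, hp', fun q hq => ?_⟩
  have := hinj (a₁ := ⟨q, hq.1⟩) (a₂ := p) (by
    ext v
    simpa [momentMap, moment] using (hq.2 v v.2).trans (hp'.2 v v.2).symm)
  exact congrArg Subtype.val this

/-- The Gauss-Radau projection of an integrable function at an endpoint exists and is unique. -/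
theorem existsUnique_isRadauProj (k : ℕ) {a b e : ℝ} (hab : a < b) (he : e = a ∨ e = b)
    (f : ℝ → ℝ) (hf : IntervalIntegrable f volume a b) :
    ∃! p, IsRadauProj k a b e f p := by
  let T : degreeLT ℝ (k + 1) →ₗ[ℝ] Module.Dual ℝ (degreeLT ℝ k) × ℝ :=
    (momentMap (k + 1) k a b).prod ((leval e).comp (degreeLT ℝ (k + 1)).subtype)
  have hinj : Function.Injective T := by
    rw [← LinearMap.ker_eq_bot, LinearMap.ker_eq_bot']
    intro d hd
    have h1 : momentMap (k + 1) k a b d = 0 := congrArg Prod.fst hd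
    have h2 : (d : ℝ[X]).eval e = 0 := congrArg Prod.snd hd
    have := isRadauProj_hom_zero hab he d.2 (fun v hv => by
      simpa [momentMap, moment] using LinearMap.congr_fun h1 ⟨v, hv⟩) h2
    exact Subtype.ext this
  have hsurj : Function.Surjective T :=
    (LinearMap.injective_iff_surjective_of_finrank_eq_finrank (by
      rw [Module.finrank_prod, Subspace.dual_finrank_eq, finrank_degreeLT, finrank_degreeLT,
        Module.finrank_self])).mp hinj
  obtain ⟨p, hp⟩ := hsurj (moment k a b f hf, f e)
  have h1 : momentMap (k + 1) k a b p = moment k a b f hf := congrArg Prod.fst hp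
  have h2 : (p : ℝ[X]).eval e = f e := congrArg Prod.snd hp
  have hp' : IsRadauProj k a b e f p := ⟨p.2, fun v hv => by
    simpa [momentMap, moment] using LinearMap.congr_fun h1 ⟨v, hv⟩, h2⟩
  refine ⟨p, hp', fun q hq => ?_⟩
  have := hinj (a₁ := ⟨q, hq.1⟩) (a₂ := p) (by
    refine Prod.ext ?_ (hq.2.2.trans h2.symm)
    ext v
    simpa [T, momentMap, moment] using (hq.2.1 v v.2).trans (hp'.2.1 v v.2).symm)
  exact congrArg Subtype.val this

/-- The `L²`-projector `π` onto `P^k(a, b)`, characterised by `existsUnique_isL2Proj`. -/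
def l2Proj (k : ℕ) (a b : ℝ) (f : ℝ → ℝ) : ℝ[X] :=
  Classical.epsilon (IsL2Proj k a b f)

/-- The Gauss-Radau projector `π⁺`, exact at the left endpoint;
characterised by `existsUnique_isRadauProj`. -/
def radauPlus (k : ℕ) (a b : ℝ) (f : ℝ → ℝ) : ℝ[X] :=
  Classical.epsilon (IsRadauProj k a b a f)

/-- The Gauss-Radau projector `π⁻`, exact at the right endpoint;
characterised by `existsUnique_isRadauProj`. -/
def radauMinus (k : ℕ) (a b : ℝ) (f : ℝ → ℝ) : ℝ[X] :=
  Classical.epsilon (IsRadauProj k a b b f)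

/-- The tensor product `P ⊗ Q` of two one-dimensional projectors, `Q` acting in the
variable `y` and `P` in the variable `x`. -/
def tensorProj (P Q : (ℝ → ℝ) → ℝ[X]) (z : ℝ × ℝ → ℝ) : ℝ × ℝ → ℝ :=
  fun p => (P fun s => (Q fun t => z (s, t)).eval p.2).eval p.1

/-! ## The Shishkin mesh -/

/-- The mesh transition parameter `τ`. -/
def transitionParam (ε β σ : ℝ) (N : ℕ) : ℝ :=
  min (σ * √ε / β * Real.log N) (1 / 4)

/-- The mesh points `x_i = y_i`, for `i = 0, …, N`. -/
def shishkinPoint (τ : ℝ) (N : ℕ) (i : ℕ) : ℝ :=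
  if 4 * i ≤ N then 4 * τ * (i / N)
  else if 4 * i ≤ 3 * N then τ + 2 * (1 - 2 * τ) * (i / N - 1 / 4)
  else 1 - 4 * τ * (1 - i / N)

/-! ## Finite elements on a tensor-product mesh

From here on `x : ℕ → ℝ` lists the points `x 0 < x 1 < ⋯ < x N` of a mesh of `[0, 1]`, used in
both coordinate directions. -/

/-- `h_i = x_i - x_{i-1}`, for `1 ≤ i`. -/
def meshWidth (x : ℕ → ℝ) (i : ℕ) : ℝ := x i - x (i - 1)

/-- The open interval `(x_{i-1}, x_i)`, for `1 ≤ i`. -/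
def cell (x : ℕ → ℝ) (i : ℕ) : Set ℝ := Ioo (x (i - 1)) (x i)

/-- The open mesh rectangle `K_{ij}`, for `1 ≤ i` and `1 ≤ j`. -/
def elem (x : ℕ → ℝ) (i j : ℕ) : Set (ℝ × ℝ) := cell x i ×ˢ cell x j

/-- `v` coincides on `K` with a polynomial of degree at most `k` in each variable. -/
def IsQkOn (k : ℕ) (K : Set (ℝ × ℝ)) (v : ℝ × ℝ → ℝ) : Prop :=
  ∃ c : ℕ → ℕ → ℝ, ∀ p ∈ K,
    v p = ∑ m ∈ Finset.range (k + 1), ∑ n ∈ Finset.range (k + 1), c m n * p.1 ^ m * p.2 ^ n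

/-- The discontinuous finite element space `V_N`; its members are functions on the open unit
square whose values on the (null) set of mesh lines are arbitrary. -/
def feSpace (k : ℕ) (x : ℕ → ℝ) (N : ℕ) : Set (ℝ × ℝ → ℝ) :=
  {v | MemLp v 2 (volume.restrict (Ioo (0 : ℝ) 1 ×ˢ Ioo (0 : ℝ) 1)) ∧
    ∀ i ∈ Finset.Icc 1 N, ∀ j ∈ Finset.Icc 1 N, IsQkOn k (elem x i j) v}

/-- The function on the union of the open mesh rectangles that equals `w i j` on `K_{ij}`. -/
def glue (x : ℕ → ℝ) (N : ℕ) (w : ℕ → ℕ → ℝ × ℝ → ℝ) : ℝ × ℝ → ℝ :=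
  fun p => ∑ i ∈ Finset.Icc 1 N, ∑ j ∈ Finset.Icc 1 N, (elem x i j).indicator (w i j) p

/-- The projector `Π_x⁺ = π⁺ ⊗ π`, applied element by element. -/
def PiXPlus (k : ℕ) (x : ℕ → ℝ) (N : ℕ) (z : ℝ × ℝ → ℝ) : ℝ × ℝ → ℝ :=
  glue x N fun i j => tensorProj (radauPlus k (x (i - 1)) (x i)) (l2Proj k (x (j - 1)) (x j)) z

/-- The projector `Π_x⁻ = π⁻ ⊗ π`, applied element by element. -/
def PiXMinus (k : ℕ) (x : ℕ → ℝ) (N : ℕ) (z : ℝ × ℝ → ℝ) : ℝ × ℝ → ℝ :=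
  glue x N fun i j => tensorProj (radauMinus k (x (i - 1)) (x i)) (l2Proj k (x (j - 1)) (x j)) z

/-- The projector `Π_y⁺ = π ⊗ π⁺`, applied element by element. -/
def PiYPlus (k : ℕ) (x : ℕ → ℝ) (N : ℕ) (z : ℝ × ℝ → ℝ) : ℝ × ℝ → ℝ :=
  glue x N fun i j => tensorProj (l2Proj k (x (i - 1)) (x i)) (radauPlus k (x (j - 1)) (x j)) z

/-- The projector `Π_y⁻ = π ⊗ π⁻`, applied element by element. -/
def PiYMinus (k : ℕ) (x : ℕ → ℝ) (N : ℕ) (z : ℝ × ℝ → ℝ) : ℝ × ℝ → ℝ :=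
  glue x N fun i j => tensorProj (l2Proj k (x (i - 1)) (x i)) (radauMinus k (x (j - 1)) (x j)) z

/-! ## Traces, jumps and averages on interior edges -/

/-- The jump of `v` across the vertical line `{a} × ℝ`, at height `y`. -/
def jumpX (v : ℝ × ℝ → ℝ) (a y : ℝ) : ℝ :=
  limUnder (𝓝[>] a) (fun s => v (s, y)) - limUnder (𝓝[<] a) (fun s => v (s, y))

/-- The average of `v` across the vertical line `{a} × ℝ`, at height `y`. -/
def avgX (v : ℝ × ℝ → ℝ) (a y : ℝ) : ℝ :=
  (limUnder (𝓝[>] a) (fun s => v (s, y)) + limUnder (𝓝[<] a) (fun s => v (s, y))) / 2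

/-- The jump of `v` across the horizontal line `ℝ × {b}`, at abscissa `x`. -/
def jumpY (v : ℝ × ℝ → ℝ) (x b : ℝ) : ℝ :=
  limUnder (𝓝[>] b) (fun t => v (x, t)) - limUnder (𝓝[<] b) (fun t => v (x, t))

/-- The average of `v` across the horizontal line `ℝ × {b}`, at abscissa `x`. -/
def avgY (v : ℝ × ℝ → ℝ) (x b : ℝ) : ℝ :=
  (limUnder (𝓝[>] b) (fun t => v (x, t)) + limUnder (𝓝[<] b) (fun t => v (x, t))) / 2

/-! ## Norms and pure partial derivatives -/

/-- The `L²(D)` norm. -/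
def l2Norm (D : Set (ℝ × ℝ)) (f : ℝ × ℝ → ℝ) : ℝ := √(∫ p in D, f p ^ 2)

/-- `∂_x^m z`. -/
def partialX (m : ℕ) (z : ℝ × ℝ → ℝ) (p : ℝ × ℝ) : ℝ := iteratedDeriv m (fun s => z (s, p.2)) p.1

/-- `∂_y^m z`. -/
def partialY (m : ℕ) (z : ℝ × ℝ → ℝ) (p : ℝ × ℝ) : ℝ := iteratedDeriv m (fun t => z (p.1, t)) p.2

end LDG

end

/-!
On each side of a vertical edge `x = m` the projection error splits as
`z - π_x π_y^± z = (z - π_x z) + π_x (z - π_y^± z)`. The first term is a one-dimensional error for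
each height `y`, of size `h^(k+1/2) ‖∂_x^(k+1) z(·, y)‖`. In the second, the value of the
`L²`-projection at `m` costs a factor `h^(-1/2)` against the `L²` norm in `x` of `z - π_y^± z`, whose
values are bounded on each vertical slice by the one-dimensional error of `π_y^±`. This is
`exists_trace_error`. The jump of `v` at `m` satisfies the inverse inequality
`|⟦v⟧| ≤ C h^(-1/2) ‖v(·, y)‖`, so the Cauchy-Schwarz inequality along the edge yields the total
factor `h⁻¹` in `exists_edge_bound`; here `h` is the common width of the two rectangles at the edge.

The one-dimensional facts are the stability of the projectors with constants that depend on `k`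
alone (finite dimension and an affine change of variables, `exists_eval_bound_of_moments`) and a
Taylor polynomial with the `L²` norm of the derivative in the remainder
(`exists_taylor_polynomial`).

Horizontal edges reduce to vertical ones by exchanging the variables. The projector `π^±_x ⊗ π_y`
then has its factors in the other order, and `tensorProj_radau_l2Proj_eq_swap` shows that they
commute.
-/

namespace LDG

/-! ### Polynomial bounds uniform in the interval -/

theorem comp_mem_degreeLT {n : ℕ} {p q : ℝ[X]} (hp : p ∈ degreeLT ℝ n) (hq : q.natDegree ≤ 1) :
    p.comp q ∈ degreeLT ℝ n := by
  by_cases h0 : p = 0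
  · simp [h0]
  have h1 : p.natDegree < n := (natDegree_lt_iff_degree_lt h0).2 (mem_degreeLT.1 hp)
  have h2 : (p.comp q).natDegree < n :=
    lt_of_le_of_lt (natDegree_comp_le.trans (by nlinarith)) h1
  rw [mem_degreeLT]
  exact degree_le_natDegree.trans_lt (by exact_mod_cast h2)

/-- In finite dimension an injective linear map is bounded below; hence its norm controls the
values of a polynomial on `[0, 1]`. -/
theorem exists_abs_eval_le {n : ℕ} {W : Type*} [NormedAddCommGroup W] [NormedSpace ℝ W]
    (T : degreeLT ℝ n →ₗ[ℝ] W) (hT : Function.Injective T) :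
    ∃ K : ℝ, 0 < K ∧ ∀ p : degreeLT ℝ n, ∀ x ∈ Icc (0 : ℝ) 1,
      |(p : ℝ[X]).eval x| ≤ K * ‖T p‖ := by
  let S : (Fin n → ℝ) →ₗ[ℝ] W := T.comp (degreeLTEquiv ℝ n).symm.toLinearMap
  have hS : LinearMap.ker S = ⊥ := by
    rw [LinearMap.ker_eq_bot]
    exact hT.comp (degreeLTEquiv ℝ n).symm.injective
  obtain ⟨K, hK, hSK⟩ := S.exists_antilipschitzWith hS
  refine ⟨(n + 1) * K, by positivity, fun p x hx => ?_⟩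
  have h1 : ‖degreeLTEquiv ℝ n p‖ ≤ K * ‖T p‖ := by
    have := hSK.le_mul_dist (degreeLTEquiv ℝ n p) 0
    simpa [S] using this
  have h2 : (p : ℝ[X]).eval x = ∑ i : Fin n, degreeLTEquiv ℝ n p i * x ^ (i : ℕ) :=
    eval_eq_sum_degreeLTEquiv p.2 x
  rw [h2]
  calc |∑ i : Fin n, degreeLTEquiv ℝ n p i * x ^ (i : ℕ)|
      ≤ ∑ i : Fin n, |degreeLTEquiv ℝ n p i * x ^ (i : ℕ)| := Finset.abs_sum_le_sum_abs _ _
    _ ≤ ∑ _i : Fin n, K * ‖T p‖ := by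
        refine Finset.sum_le_sum fun i _ => ?_
        rw [abs_mul]
        have h3 : |degreeLTEquiv ℝ n p i| ≤ K * ‖T p‖ := (norm_le_pi_norm _ i).trans h1
        have h4 : |x ^ (i : ℕ)| ≤ 1 := by
          rw [abs_of_nonneg (pow_nonneg hx.1 _)]
          exact pow_le_one₀ hx.1 hx.2
        calc _ ≤ |degreeLTEquiv ℝ n p i| * 1 := by gcongr
          _ ≤ _ := by rwa [mul_one]
    _ = n * (K * ‖T p‖) := by simp
    _ ≤ (n + 1) * K * ‖T p‖ := by
        have : 0 ≤ K * ‖T p‖ := by positivity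
        nlinarith

/-- A polynomial on `[a, b]` is controlled by its moments and, if `c ≠ 0`, one point value, as soon
as these data determine polynomials on `[0, 1]`. The constant does not depend on `[a, b]`: the
moments are tested against polynomials bounded by `1`, a condition invariant under the affine map
from `[0, 1]`. With `c = 0` the point value plays no role, which is the case of the `L²`-projection;
with `c = 1` and `θ` an endpoint of `[0, 1]` it is the case of the Gauss-Radau projections. -/
theorem exists_eval_bound_of_moments (k n : ℕ) (c θ : ℝ)
    (hinj : ∀ d ∈ degreeLT ℝ (k + 1),
      (∀ v ∈ degreeLT ℝ n, ∫ x in (0 : ℝ)..1, d.eval x * v.eval x = 0) →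
        c * d.eval θ = 0 → d = 0) :
    ∃ K : ℝ, 0 < K ∧ ∀ a b : ℝ, a < b → ∀ p ∈ degreeLT ℝ (k + 1), ∀ M : ℝ,
      (∀ v ∈ degreeLT ℝ n, (∀ x ∈ Icc a b, |v.eval x| ≤ 1) →
        |∫ x in a..b, p.eval x * v.eval x| ≤ (b - a) * M) →
      |c * p.eval ((b - a) * θ + a)| ≤ M → ∀ x ∈ Icc a b, |p.eval x| ≤ K * M := by
  let T : degreeLT ℝ (k + 1) →ₗ[ℝ] (Fin n → ℝ) × ℝ :=
    (LinearMap.pi fun i : Fin n =>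
      (LinearMap.applyₗ (degreeLT.basis ℝ n i)).comp (momentMap (k + 1) n 0 1)).prod
    (c • (leval θ).comp (degreeLT ℝ (k + 1)).subtype)
  have hT : Function.Injective T := by
    rw [← LinearMap.ker_eq_bot, LinearMap.ker_eq_bot']
    intro d hd
    have h1 := congrArg Prod.fst hd
    have h2 : c * (d : ℝ[X]).eval θ = 0 := congrArg Prod.snd hd
    have h3 : momentMap (k + 1) n 0 1 d = 0 :=
      (degreeLT.basis ℝ n).ext fun i => congrFun h1 i
    refine Subtype.ext (hinj d d.2 (fun v hv => ?_) h2)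
    simpa [momentMap, moment] using LinearMap.congr_fun h3 ⟨v, hv⟩
  obtain ⟨K, hK, hKT⟩ := exists_abs_eval_le T hT
  refine ⟨K, hK, fun a b hab p hp M hmom hpt x hx => ?_⟩
  have hh : 0 < b - a := sub_pos.2 hab
  have hM : 0 ≤ M := (abs_nonneg _).trans hpt
  have hq : p.comp (C (b - a) * X + C a) ∈ degreeLT ℝ (k + 1) :=
    comp_mem_degreeLT hp natDegree_linear_le
  have hTq : ‖T ⟨_, hq⟩‖ ≤ M := by
    refine norm_prod_le_iff.2 ⟨(pi_norm_le_iff_of_nonneg hM).2 fun i => ?_, ?_⟩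
    · have hv : ((X : ℝ[X]) ^ (i : ℕ)).comp (C (b - a)⁻¹ * X + C (-(b - a)⁻¹ * a)) ∈
          degreeLT ℝ n := by
        refine comp_mem_degreeLT ?_ natDegree_linear_le
        rw [mem_degreeLT, degree_X_pow]
        exact_mod_cast i.2
      have h1 := hmom _ hv (fun y hy => by
        have h2 : (b - a)⁻¹ * y + -(b - a)⁻¹ * a = (y - a) / (b - a) := by field_simp; ring
        have h3 : 0 ≤ (y - a) / (b - a) := div_nonneg (by linarith [hy.1]) hh.le
        have h4 : (y - a) / (b - a) ≤ 1 := (div_le_one hh).2 (by linarith [hy.2])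
        simp only [eval_comp, eval_pow, eval_X, eval_add, eval_mul, eval_C, h2]
        rw [abs_of_nonneg (pow_nonneg h3 _)]
        exact pow_le_one₀ h3 h4)
      have h5 : ∫ x in a..b, p.eval x *
          (((X : ℝ[X]) ^ (i : ℕ)).comp (C (b - a)⁻¹ * X + C (-(b - a)⁻¹ * a))).eval x =
          (b - a) * ∫ t in (0 : ℝ)..1, (p.comp (C (b - a) * X + C a)).eval t * t ^ (i : ℕ) := by
        have := intervalIntegral.mul_integral_comp_mul_add (a := 0) (b := 1)
          (f := fun x => p.eval x *
          (((X : ℝ[X]) ^ (i : ℕ)).comp (C (b - a)⁻¹ * X + C (-(b - a)⁻¹ * a))).eval x) (b - a) a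
        simp only [mul_zero, zero_add, mul_one, sub_add_cancel] at this
        rw [← this]
        congr 1
        refine intervalIntegral.integral_congr fun t _ => ?_
        simp only [eval_comp, eval_pow, eval_X, eval_add, eval_mul, eval_C]
        congr 2
        field_simp
        ring
      rw [h5, abs_mul, abs_of_pos hh] at h1
      have h6 := le_of_mul_le_mul_left h1 hh
      have h7 : (T ⟨_, hq⟩).1 i =
          ∫ t in (0 : ℝ)..1, (p.comp (C (b - a) * X + C a)).eval t * t ^ (i : ℕ) := by
        simp [T, momentMap, moment]
      rw [Real.norm_eq_abs, h7]
      exact h6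
    · have : (T ⟨_, hq⟩).2 = c * p.eval ((b - a) * θ + a) := by
        simp [T, leval, eval_comp]
      rw [this]
      exact hpt
  have h := hKT ⟨_, hq⟩ ((x - a) / (b - a))
    ⟨div_nonneg (by linarith [hx.1]) hh.le, (div_le_one hh).2 (by linarith [hx.2])⟩
  have h8 : (p.comp (C (b - a) * X + C a)).eval ((x - a) / (b - a)) = p.eval x := by
    simp only [eval_comp, eval_X, eval_add, eval_mul, eval_C]
    congr 1
    field_simp
    ring
  simp only [h8] at h
  exact h.trans (by gcongr)

theorem abs_integral_mul_le_sqrt_mul_sqrt {α : Type*} [MeasurableSpace α] {μ : Measure α}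
    {f g : α → ℝ} (hf : MemLp f 2 μ) (hg : MemLp g 2 μ) :
    |∫ x, f x * g x ∂μ| ≤ √(∫ x, f x ^ 2 ∂μ) * √(∫ x, g x ^ 2 ∂μ) := by
  have h := integral_mul_le_Lp_mul_Lq_of_nonneg (μ := μ) (p := 2) (q := 2)
    Real.HolderConjugate.two_two (f := fun x => |f x|) (g := fun x => |g x|)
    (Eventually.of_forall fun _ => abs_nonneg _) (Eventually.of_forall fun _ => abs_nonneg _)
    (by simpa using hf.norm) (by simpa using hg.norm)
  simp only [Real.rpow_two, sq_abs, ← Real.sqrt_eq_rpow] at h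
  refine le_trans ?_ h
  simpa [abs_mul] using abs_integral_le_integral_abs (f := fun x => f x * g x) (μ := μ)

theorem memLp_Ioo_of_continuousOn_Icc {a b : ℝ} {f : ℝ → ℝ} (hf : ContinuousOn f (Icc a b)) :
    MemLp f 2 (volume.restrict (Ioo a b)) := by
  obtain ⟨M, hM⟩ := isCompact_Icc.exists_bound_of_continuousOn hf
  refine MemLp.of_bound ((hf.mono Ioo_subset_Icc_self).aestronglyMeasurable measurableSet_Ioo) M ?_
  exact (ae_restrict_iff' measurableSet_Ioo).2
    (Eventually.of_forall fun x hx => hM x (Ioo_subset_Icc_self hx))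

theorem intervalIntegral_eq_integral_Ioo {a b : ℝ} (hab : a ≤ b) (f : ℝ → ℝ) :
    ∫ x in a..b, f x = ∫ x in Ioo a b, f x := by
  rw [intervalIntegral.integral_of_le hab, integral_Ioc_eq_integral_Ioo]

theorem integral_Ioo_sq_le {a b : ℝ} (hab : a ≤ b) {f : ℝ → ℝ} {M : ℝ}
    (hf : ∀ x ∈ Ioo a b, f x ^ 2 ≤ M) : ∫ x in Ioo a b, f x ^ 2 ≤ (b - a) * M := by
  have h := norm_setIntegral_le_of_norm_le_const (μ := volume) (s := Ioo a b) (C := M)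
    (f := fun x => f x ^ 2) (by simp) (fun x hx => by simpa using hf x hx)
  simp only [Measure.real, Real.volume_Ioo, ENNReal.toReal_ofReal (sub_nonneg.2 hab)] at h
  exact (le_abs_self _).trans (by rw [mul_comm]; exact h)

theorem abs_integral_mul_le_of_abs_le {a b : ℝ} (hab : a ≤ b) {f g : ℝ → ℝ} {M : ℝ}
    (hf : ∀ x ∈ Icc a b, |f x| ≤ M) (hg : ∀ x ∈ Icc a b, |g x| ≤ 1) :
    |∫ x in a..b, f x * g x| ≤ (b - a) * M := by
  have h := intervalIntegral.norm_integral_le_of_norm_le_const (a := a) (b := b) (C := M)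
    (f := fun x => f x * g x) (fun x hx => by
      rw [uIoc_of_le hab] at hx
      have hx' : x ∈ Icc a b := ⟨hx.1.le, hx.2⟩
      rw [norm_mul]
      calc ‖f x‖ * ‖g x‖ ≤ M * 1 := by
            gcongr
            · exact (abs_nonneg _).trans (hf x hx')
            · exact hf x hx'
            · exact hg x hx'
        _ = M := mul_one M)
  rw [abs_of_nonneg (sub_nonneg.2 hab), mul_comm] at h
  exact h

/-- The `L²`-projection is stable from the sup norm to the sup norm, and from `L²` to the sup norm
at the cost of a factor `(b - a)^(-1/2)`. As a polynomial is its own projection, the second bound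
contains the inverse inequality for polynomials. -/
theorem exists_l2Proj_bound (k : ℕ) :
    ∃ K : ℝ, 0 < K ∧ ∀ (a b : ℝ), a < b → ∀ (g : ℝ → ℝ) (p : ℝ[X]), IsL2Proj k a b g p →
      (∀ M, (∀ x ∈ Icc a b, |g x| ≤ M) → ∀ x ∈ Icc a b, |p.eval x| ≤ K * M) ∧
      (MemLp g 2 (volume.restrict (Ioo a b)) → ∀ x ∈ Icc a b,
        |p.eval x| ≤ K * (√(∫ s in Ioo a b, g s ^ 2) / √(b - a))) := by
  obtain ⟨K, hK, h⟩ := exists_eval_bound_of_moments k (k + 1) 0 0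
    (fun d hd hv _ => isL2Proj_hom_zero one_pos hd hv)
  refine ⟨K, hK, fun a b hab g p hp => ⟨fun M hM x hx => ?_, fun hg x hx => ?_⟩⟩
  · have hM0 : 0 ≤ M := (abs_nonneg _).trans (hM x hx)
    refine h a b hab p hp.1 M (fun v hv hv1 => ?_) (by simpa using hM0) x hx
    rw [hp.2 v hv]
    exact abs_integral_mul_le_of_abs_le hab.le hM hv1
  · refine h a b hab p hp.1 _ (fun v hv hv1 => ?_) (by simp; positivity) x hx
    have hh : 0 < b - a := sub_pos.2 hab
    rw [hp.2 v hv, intervalIntegral_eq_integral_Ioo hab.le]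
    refine (abs_integral_mul_le_sqrt_mul_sqrt hg
      (memLp_Ioo_of_continuousOn_Icc v.continuous.continuousOn)).trans ?_
    have h1 : √(∫ x in Ioo a b, v.eval x ^ 2) ≤ √(b - a) := by
      apply Real.sqrt_le_sqrt
      simpa using integral_Ioo_sq_le hab.le (f := fun x => v.eval x) (M := 1)
        (fun x hx => (sq_le_one_iff_abs_le_one _).2 (hv1 x (Ioo_subset_Icc_self hx)))
    calc _ ≤ √(∫ x in Ioo a b, g x ^ 2) * √(b - a) := by gcongr
      _ = _ := by
        rw [mul_div_assoc', eq_div_iff (by positivity)]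
        rw [mul_assoc, Real.mul_self_sqrt hh.le, mul_comm]

/-- The Gauss-Radau projections are stable in the sup norm; because of the point value they are not
stable in `L²`. -/
theorem exists_radau_bound (k : ℕ) :
    ∃ K : ℝ, 0 < K ∧ ∀ (a b e : ℝ), a < b → (e = a ∨ e = b) → ∀ (g : ℝ → ℝ) (p : ℝ[X]),
      IsRadauProj k a b e g p →
      ∀ M, (∀ x ∈ Icc a b, |g x| ≤ M) → ∀ x ∈ Icc a b, |p.eval x| ≤ K * M := by
  obtain ⟨K₀, hK₀, h₀⟩ := exists_eval_bound_of_moments k k 1 0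
    (fun d hd hv he => isRadauProj_hom_zero one_pos (Or.inl rfl) hd hv (by simpa using he))
  obtain ⟨K₁, hK₁, h₁⟩ := exists_eval_bound_of_moments k k 1 1
    (fun d hd hv he => isRadauProj_hom_zero one_pos (Or.inr rfl) hd hv (by simpa using he))
  refine ⟨K₀ + K₁, by positivity, fun a b e hab he g p hp M hM x hx => ?_⟩
  have hM0 : 0 ≤ M := (abs_nonneg _).trans (hM x hx)
  have hmom : ∀ v ∈ degreeLT ℝ k, (∀ x ∈ Icc a b, |v.eval x| ≤ 1) →
        |∫ x in a..b, p.eval x * v.eval x| ≤ (b - a) * M := fun v hv hv1 => by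
    rw [hp.2.1 v hv]
    exact abs_integral_mul_le_of_abs_le hab.le hM hv1
  have hpe := hp.2.2
  rcases he with rfl | rfl
  · refine (h₀ e b hab p hp.1 M hmom ?_ x hx).trans (by gcongr; linarith)
    simpa [hpe] using hM e (left_mem_Icc.2 hab.le)
  · refine (h₁ a e hab p hp.1 M hmom ?_ x hx).trans (by gcongr; linarith)
    simpa [hpe] using hM e (right_mem_Icc.2 hab.le)

/-! ### One-dimensional approximation -/

theorem iteratedDerivWithin_Icc_eq_of_mem_Ioo {n : ℕ} {f : ℝ → ℝ} {a b x : ℝ}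
    (hx : x ∈ Ioo a b) : iteratedDerivWithin n f (Icc a b) x = iteratedDeriv n f x := by
  have h : (Icc a b : Set ℝ) =ᶠ[𝓝 x] univ := by
    rw [eventuallyEq_univ]
    exact Icc_mem_nhds hx.1 hx.2
  rw [← iteratedDerivWithin_univ, iteratedDerivWithin, iteratedDerivWithin,
    iteratedFDerivWithin_congr_set h]

theorem memLp_iteratedDeriv {n : ℕ} {f : ℝ → ℝ} {a b : ℝ} (hab : a < b)
    (hf : ContDiffOn ℝ n f (Icc a b)) :
    MemLp (iteratedDeriv n f) 2 (volume.restrict (Ioo a b)) := by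
  refine (memLp_Ioo_of_continuousOn_Icc (hf.continuousOn_iteratedDerivWithin le_rfl
    (uniqueDiffOn_Icc hab))).ae_eq ?_
  exact (ae_restrict_iff' measurableSet_Ioo).2
    (Eventually.of_forall fun x hx => iteratedDerivWithin_Icc_eq_of_mem_Ioo hx)

/-- The Taylor polynomial at the left endpoint approximates `f` uniformly, with the `L²` norm of the
highest derivative on the right. The derivative is the two-sided one, since only its values on the
open interval matter. -/
theorem exists_taylor_polynomial {k : ℕ} {f : ℝ → ℝ} {a b : ℝ} (hab : a < b)
    (hf : ContDiffOn ℝ (k + 1 : ℕ) f (Icc a b)) :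
    ∃ T ∈ degreeLT ℝ (k + 1), ∀ x ∈ Icc a b, |f x - T.eval x| ≤
      (b - a) ^ k * (√(b - a) * √(∫ s in Ioo a b, iteratedDeriv (k + 1) f s ^ 2)) := by
  have hh : 0 < b - a := sub_pos.2 hab
  let T : ℝ[X] := ∑ m ∈ Finset.range (k + 1),
    (C (((m.factorial : ℝ)⁻¹) * iteratedDerivWithin m f (Icc a b) a) * X ^ m).comp
      (C 1 * X + C (-a))
  refine ⟨T, Submodule.sum_mem _ fun m hm => comp_mem_degreeLT ?_ natDegree_linear_le,
    fun x hx => ?_⟩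
  · rw [mem_degreeLT]
    exact (degree_C_mul_X_pow_le _ _).trans_lt (by exact_mod_cast Finset.mem_range.1 hm)
  have hT : T.eval x = taylorWithinEval f k (Icc a b) a x := by
    rw [taylor_within_apply]
    simp only [T, eval_finsetSum]
    refine Finset.sum_congr rfl fun m _ => ?_
    simp only [eval_comp, eval_mul, eval_C, eval_pow, eval_X, eval_add, smul_eq_mul]
    ring
  rw [hT]
  rcases eq_or_lt_of_le hx.1 with rfl | hax
  · simp only [taylorWithinEval_self, sub_self, abs_zero]
    positivity
  -- the remainder formula uses derivatives within `[a, x]`; at `a` they agree with those within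
  -- `[a, b]`, so the Taylor polynomial does not depend on `x`
  have hset : (Icc a b : Set ℝ) =ᶠ[𝓝 a] uIcc a x := by
    rw [uIcc_of_le hax.le]
    filter_upwards [Iio_mem_nhds hax] with t ht
    refine propext ⟨fun h => ⟨h.1, le_of_lt ht⟩, fun h => ⟨h.1, h.2.trans hx.2⟩⟩
  have hT' : taylorWithinEval f k (Icc a b) a x = taylorWithinEval f k (uIcc a x) a x := by
    simp only [taylor_within_apply]
    refine Finset.sum_congr rfl fun m _ => ?_
    rw [iteratedDerivWithin, iteratedDerivWithin, iteratedFDerivWithin_congr_set hset]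
  have hsub : uIcc a x ⊆ Icc a b := by
    rw [uIcc_of_le hax.le]; exact Icc_subset_Icc_right hx.2
  have hcd := hf.mono hsub
  rw [hT', taylor_integral_remainder hcd, intervalIntegral_eq_integral_Ioo hax.le]
  have hD : MemLp (iteratedDeriv (k + 1) f) 2 (volume.restrict (Ioo a b)) :=
    memLp_iteratedDeriv hab hf
  have hsub' : Ioo a x ⊆ Ioo a b := Ioo_subset_Ioo_right hx.2
  have h1 : ∫ t in Ioo a x, ((x - t) ^ k / (k.factorial : ℝ)) •
        iteratedDerivWithin (k + 1) f (uIcc a x) t =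
      ∫ t in Ioo a x, ((x - t) ^ k / (k.factorial : ℝ)) * iteratedDeriv (k + 1) f t := by
    refine setIntegral_congr_fun measurableSet_Ioo fun t ht => ?_
    simp only [uIcc_of_le hax.le, smul_eq_mul]
    rw [iteratedDerivWithin_Icc_eq_of_mem_Ioo ht]
  rw [h1]
  have hw : ContinuousOn (fun t => (x - t) ^ k / (k.factorial : ℝ)) (Icc a x) := by fun_prop
  refine (abs_integral_mul_le_sqrt_mul_sqrt (memLp_Ioo_of_continuousOn_Icc hw)
    (hD.mono_measure (Measure.restrict_mono hsub' le_rfl))).trans ?_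
  rw [← mul_assoc]
  gcongr ?_ * ?_
  · rw [Real.sqrt_le_iff]
    refine ⟨by positivity, ?_⟩
    refine (integral_Ioo_sq_le hax.le (M := ((b - a) ^ k) ^ 2) fun t ht => ?_).trans ?_
    · have hxt : 0 ≤ x - t := sub_nonneg.2 ht.2.le
      have h2 : (x - t) ^ k / (k.factorial : ℝ) ≤ (x - t) ^ k :=
        div_le_self (by positivity) (by exact_mod_cast Nat.one_le_iff_ne_zero.2 k.factorial_ne_zero)
      have h3 : (x - t) ^ k ≤ (b - a) ^ k :=
        pow_le_pow_left₀ hxt (by linarith [ht.1, hx.2]) k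
      exact pow_le_pow_left₀ (by positivity) (h2.trans h3) 2
    · rw [mul_pow, Real.sq_sqrt hh.le, mul_comm]
      gcongr
      exact hx.2
  · exact Real.sqrt_le_sqrt (setIntegral_mono_set hD.integrable_sq
      (Eventually.of_forall fun _ => sq_nonneg _) (Eventually.of_forall hsub'))

theorem isL2Proj_self {k : ℕ} {a b : ℝ} {T : ℝ[X]} (hT : T ∈ degreeLT ℝ (k + 1)) :
    IsL2Proj k a b (fun x => T.eval x) T :=
  ⟨hT, fun _ _ => rfl⟩

theorem isRadauProj_self {k : ℕ} {a b e : ℝ} {T : ℝ[X]} (hT : T ∈ degreeLT ℝ (k + 1)) :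
    IsRadauProj k a b e (fun x => T.eval x) T :=
  ⟨hT, fun _ _ => rfl, rfl⟩

theorem IsL2Proj.sub {k : ℕ} {a b : ℝ} {f g : ℝ → ℝ} {p q : ℝ[X]}
    (hf : IntervalIntegrable f volume a b) (hg : IntervalIntegrable g volume a b)
    (hp : IsL2Proj k a b f p) (hq : IsL2Proj k a b g q) :
    IsL2Proj k a b (fun x => f x - g x) (p - q) := by
  refine ⟨Submodule.sub_mem _ hp.1 hq.1, fun v hv => ?_⟩
  have h {u : ℝ → ℝ} (hu : IntervalIntegrable u volume a b) :=
    hu.mul_continuousOn v.continuous.continuousOn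
  simp only [eval_sub, sub_mul]
  rw [intervalIntegral.integral_sub (h (poly_intervalIntegrable p a b))
    (h (poly_intervalIntegrable q a b)), intervalIntegral.integral_sub (h hf) (h hg),
    hp.2 v hv, hq.2 v hv]

theorem IsRadauProj.sub {k : ℕ} {a b e : ℝ} {f g : ℝ → ℝ} {p q : ℝ[X]}
    (hf : IntervalIntegrable f volume a b) (hg : IntervalIntegrable g volume a b)
    (hp : IsRadauProj k a b e f p) (hq : IsRadauProj k a b e g q) :
    IsRadauProj k a b e (fun x => f x - g x) (p - q) := by
  refine ⟨Submodule.sub_mem _ hp.1 hq.1, fun v hv => ?_, by simp [hp.2.2, hq.2.2]⟩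
  have h {u : ℝ → ℝ} (hu : IntervalIntegrable u volume a b) :=
    hu.mul_continuousOn v.continuous.continuousOn
  simp only [eval_sub, sub_mul]
  rw [intervalIntegral.integral_sub (h (poly_intervalIntegrable p a b))
    (h (poly_intervalIntegrable q a b)), intervalIntegral.integral_sub (h hf) (h hg),
    hp.2.1 v hv, hq.2.1 v hv]

/-- The projection error is bounded by `f - T` and the projection of `f - T`. -/
theorem abs_sub_eval_le_of_stable {K M a b : ℝ} {f : ℝ → ℝ} {p T : ℝ[X]}
    (hT : ∀ x ∈ Icc a b, |f x - T.eval x| ≤ M)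
    (hp : ∀ x ∈ Icc a b, |(p - T).eval x| ≤ K * M) :
    ∀ x ∈ Icc a b, |f x - p.eval x| ≤ (1 + K) * M := by
  intro x hx
  have h1 : f x - p.eval x = (f x - T.eval x) - (p - T).eval x := by simp
  rw [h1]
  refine (abs_sub _ _).trans ?_
  linarith [hT x hx, hp x hx]

theorem exists_l2Proj_error (k : ℕ) :
    ∃ K : ℝ, 0 < K ∧ ∀ (a b : ℝ), a < b → ∀ (f : ℝ → ℝ) (p : ℝ[X]),
      ContDiffOn ℝ (k + 1 : ℕ) f (Icc a b) → IsL2Proj k a b f p → ∀ x ∈ Icc a b,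
        |f x - p.eval x| ≤ K * ((b - a) ^ k *
          (√(b - a) * √(∫ s in Ioo a b, iteratedDeriv (k + 1) f s ^ 2))) := by
  obtain ⟨K, hK, h⟩ := exists_l2Proj_bound k
  refine ⟨1 + K, by positivity, fun a b hab f p hf hp => ?_⟩
  obtain ⟨T, hT, hfT⟩ := exists_taylor_polynomial hab hf
  exact abs_sub_eval_le_of_stable hfT ((h a b hab _ _
    (.sub (hf.continuousOn.intervalIntegrable_of_Icc hab.le) (poly_intervalIntegrable T a b)
      hp (isL2Proj_self hT))).1 _ hfT)

theorem exists_radau_error (k : ℕ) :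
    ∃ K : ℝ, 0 < K ∧ ∀ (a b e : ℝ), a < b → (e = a ∨ e = b) → ∀ (f : ℝ → ℝ) (p : ℝ[X]),
      ContDiffOn ℝ (k + 1 : ℕ) f (Icc a b) → IsRadauProj k a b e f p → ∀ x ∈ Icc a b,
        |f x - p.eval x| ≤ K * ((b - a) ^ k *
          (√(b - a) * √(∫ s in Ioo a b, iteratedDeriv (k + 1) f s ^ 2))) := by
  obtain ⟨K, hK, h⟩ := exists_radau_bound k
  refine ⟨1 + K, by positivity, fun a b e hab he f p hf hp => ?_⟩
  obtain ⟨T, hT, hfT⟩ := exists_taylor_polynomial hab hf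
  exact abs_sub_eval_le_of_stable hfT (h a b e hab he _ _
    (.sub (hf.continuousOn.intervalIntegrable_of_Icc hab.le) (poly_intervalIntegrable T a b)
      hp (isRadauProj_self hT)) _ hfT)

/-! ### The projectors as functionals -/

/-- The Gauss-Radau projector exact at `e`; `radauPlus` and `radauMinus` are the cases of the two
endpoints. -/
noncomputable def radau (k : ℕ) (a b e : ℝ) (f : ℝ → ℝ) : ℝ[X] :=
  Classical.epsilon (IsRadauProj k a b e f)

theorem isL2Proj_l2Proj (k : ℕ) {a b : ℝ} (hab : a < b) {f : ℝ → ℝ}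
    (hf : IntervalIntegrable f volume a b) : IsL2Proj k a b f (l2Proj k a b f) :=
  Classical.epsilon_spec (existsUnique_isL2Proj k hab f hf).exists

theorem isRadauProj_radau (k : ℕ) {a b e : ℝ} (hab : a < b) (he : e = a ∨ e = b) {f : ℝ → ℝ}
    (hf : IntervalIntegrable f volume a b) : IsRadauProj k a b e f (radau k a b e f) :=
  Classical.epsilon_spec (existsUnique_isRadauProj k hab he f hf).exists

/-- Point values of the `L²`-projection are integrals against a polynomial, the Riesz representer of
the evaluation. -/
theorem exists_l2Proj_kernel (k : ℕ) {a b : ℝ} (hab : a < b) (x : ℝ) :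
    ∃ κ : ℝ[X], ∀ f : ℝ → ℝ, IntervalIntegrable f volume a b →
      (l2Proj k a b f).eval x = ∫ t in a..b, f t * κ.eval t := by
  have hinj : Function.Injective (momentMap (k + 1) (k + 1) a b) := by
    rw [← LinearMap.ker_eq_bot, LinearMap.ker_eq_bot']
    intro d hd
    exact Subtype.ext (isL2Proj_hom_zero hab d.2 (fun v hv => by
      simpa [momentMap, moment] using LinearMap.congr_fun hd ⟨v, hv⟩))
  have hsurj : Function.Surjective (momentMap (k + 1) (k + 1) a b) :=
    (LinearMap.injective_iff_surjective_of_finrank_eq_finrank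
      (Subspace.dual_finrank_eq).symm).mp hinj
  obtain ⟨κ, hκ⟩ := hsurj ((leval x).comp (degreeLT ℝ (k + 1)).subtype)
  refine ⟨κ, fun f hf => ?_⟩
  have hp := isL2Proj_l2Proj k hab hf
  rw [← hp.2 κ κ.2]
  have := LinearMap.congr_fun hκ ⟨_, hp.1⟩
  simp only [momentMap, moment, LinearMap.coe_mk, AddHom.coe_mk, LinearMap.comp_apply,
    Submodule.subtype_apply, leval_apply] at this
  rw [← this]
  simp only [mul_comm]

/-- Point values of a Gauss-Radau projection are an integral against a polynomial plus a multiple of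
the interpolated value. -/
theorem exists_radau_kernel (k : ℕ) {a b e : ℝ} (hab : a < b) (he : e = a ∨ e = b) (x : ℝ) :
    ∃ (κ : ℝ[X]) (c : ℝ), ∀ f : ℝ → ℝ, IntervalIntegrable f volume a b →
      (radau k a b e f).eval x = (∫ t in a..b, f t * κ.eval t) + c * f e := by
  let E (y : ℝ) : Module.Dual ℝ (degreeLT ℝ (k + 1)) :=
    (leval y).comp (degreeLT ℝ (k + 1)).subtype
  let S : degreeLT ℝ k × ℝ →ₗ[ℝ] Module.Dual ℝ (degreeLT ℝ (k + 1)) :=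
    (momentMap k (k + 1) a b).coprod (LinearMap.toSpanSingleton ℝ _ (E e))
  have hS (κ : degreeLT ℝ k) (c : ℝ) (p : degreeLT ℝ (k + 1)) :
      S (κ, c) p = (∫ t in a..b, (κ : ℝ[X]).eval t * (p : ℝ[X]).eval t) +
        c * (p : ℝ[X]).eval e := by
    simp [S, E, momentMap, moment]
  -- `(κ, c)` in the kernel makes `(X - e) κ` orthogonal to `P^{k-1}` and zero at `e`, so it
  -- vanishes by the unisolvence of the Gauss-Radau conditions
  have hinj : Function.Injective S := by
    rw [← LinearMap.ker_eq_bot, LinearMap.ker_eq_bot']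
    rintro ⟨κ, c⟩ hκ
    have hmem : ∀ v ∈ degreeLT ℝ k, (X - C e) * v ∈ degreeLT ℝ (k + 1) := fun v hv => by
      by_cases hv0 : v = 0
      · simp [hv0]
      rw [mem_degreeLT, degree_eq_natDegree hv0] at hv
      rw [mem_degreeLT, degree_mul, degree_X_sub_C, degree_eq_natDegree hv0]
      have h1 : v.natDegree < k := by exact_mod_cast hv
      exact_mod_cast (by omega : 1 + v.natDegree < k + 1)
    have h1 : (X - C e) * (κ : ℝ[X]) = 0 := by
      refine isRadauProj_hom_zero hab he (hmem κ κ.2) (fun v hv => ?_) (by simp)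
      have h2 := hS κ c ⟨_, hmem v hv⟩
      rw [hκ] at h2
      simp only [LinearMap.zero_apply, eval_mul, eval_sub, eval_X, eval_C, sub_self, zero_mul,
        mul_zero, add_zero] at h2
      rw [h2]
      refine intervalIntegral.integral_congr fun t _ => ?_
      simp only [eval_mul, eval_sub, eval_X, eval_C]
      ring
    have hκ0 : κ = 0 :=
      Subtype.ext ((mul_eq_zero.1 h1).resolve_left (X_sub_C_ne_zero e))
    have h3 := hS κ c ⟨1, by
      rw [mem_degreeLT]
      exact degree_one_le.trans_lt (by exact_mod_cast Nat.succ_pos k)⟩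
    rw [hκ, hκ0] at h3
    have hc : c = 0 := by simpa using h3.symm
    rw [hκ0, hc]
    rfl
  have hsurj : Function.Surjective S :=
    (LinearMap.injective_iff_surjective_of_finrank_eq_finrank (by
      rw [Module.finrank_prod, Subspace.dual_finrank_eq, finrank_degreeLT, finrank_degreeLT,
        Module.finrank_self])).mp hinj
  obtain ⟨⟨κ, c⟩, hκ⟩ := hsurj (E x)
  refine ⟨κ, c, fun f hf => ?_⟩
  have hp := isRadauProj_radau k hab he hf
  have h1 := hS κ c ⟨_, hp.1⟩
  rw [hκ] at h1
  simp only [E, LinearMap.comp_apply, Submodule.subtype_apply, leval_apply] at h1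
  rw [h1, ← hp.2.1 κ κ.2, hp.2.2]
  simp only [mul_comm]

/-! ### Partial derivatives and slices on a rectangle -/

theorem uniqueDiffOn_rect {a b c d : ℝ} (hab : a < b) (hcd : c < d) :
    UniqueDiffOn ℝ (Icc a b ×ˢ Icc c d) :=
  (uniqueDiffOn_Icc hab).prod (uniqueDiffOn_Icc hcd)

/-- The one-dimensional derivatives of a horizontal slice are values of the iterated Fréchet
derivative; this gives their joint continuity. -/
theorem iteratedDerivWithin_slice_eq {n : ℕ} {z : ℝ × ℝ → ℝ} {a b c d y : ℝ} (hab : a < b)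
    (hcd : c < d) (hz : ContDiffOn ℝ n z (Icc a b ×ˢ Icc c d)) (hy : y ∈ Icc c d) (m : ℕ)
    (hm : m ≤ n) :
    ∀ s ∈ Icc a b, iteratedDerivWithin m (fun s => z (s, y)) (Icc a b) s =
      iteratedFDerivWithin ℝ m z (Icc a b ×ˢ Icc c d) (s, y) (fun _ => ((1 : ℝ), (0 : ℝ))) := by
  induction m with
  | zero => intro s _; simp
  | succ m ih =>
    intro s hs
    have ih' := ih (by omega)
    rw [iteratedDerivWithin_succ, derivWithin_congr ih' (ih' s hs),
      iteratedFDerivWithin_succ_apply_left]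
    have h1 := hz.differentiableOn_iteratedFDerivWithin (m := m) (by exact_mod_cast hm)
      (uniqueDiffOn_rect hab hcd) (s, y) ⟨hs, hy⟩
    have h2 : HasDerivWithinAt (fun s : ℝ => (s, y)) ((1 : ℝ), (0 : ℝ)) (Icc a b) s :=
      (hasDerivWithinAt_id s _).prodMk (hasDerivWithinAt_const s _ y)
    have h3 := h1.hasFDerivWithinAt.comp_hasDerivWithinAt s h2
      (fun t ht => (⟨ht, hy⟩ : (t, y) ∈ Icc a b ×ˢ Icc c d))
    have h4 := (ContinuousMultilinearMap.apply ℝ (fun _ : Fin m => ℝ × ℝ) ℝ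
      (fun _ => ((1 : ℝ), (0 : ℝ)))).hasFDerivAt.comp_hasDerivWithinAt s h3
    exact h4.derivWithin (uniqueDiffOn_Icc hab s hs)

theorem integrableOn_partialX_sq {n : ℕ} {z : ℝ × ℝ → ℝ} {a b c d : ℝ} (hab : a < b)
    (hcd : c < d) (hz : ContDiffOn ℝ n z (Icc a b ×ˢ Icc c d)) :
    IntegrableOn (fun p => partialX n z p ^ 2) (Ioo a b ×ˢ Ioo c d) := by
  have h1 : ContinuousOn (fun p => iteratedFDerivWithin ℝ n z (Icc a b ×ˢ Icc c d) p
      (fun _ => ((1 : ℝ), (0 : ℝ))) ^ 2) (Icc a b ×ˢ Icc c d) :=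
    (((ContinuousMultilinearMap.apply ℝ (fun _ : Fin n => ℝ × ℝ) ℝ
      (fun _ => ((1 : ℝ), (0 : ℝ)))).continuous.comp_continuousOn
      (hz.continuousOn_iteratedFDerivWithin le_rfl (uniqueDiffOn_rect hab hcd)))).pow 2
  refine ((h1.integrableOn_compact (isCompact_Icc.prod isCompact_Icc)).mono_set
    (prod_mono Ioo_subset_Icc_self Ioo_subset_Icc_self)).congr_fun (fun p hp => ?_)
    (measurableSet_Ioo.prod measurableSet_Ioo)
  have h2 := iteratedDerivWithin_slice_eq hab hcd hz (Ioo_subset_Icc_self hp.2) n le_rfl p.1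
    (Ioo_subset_Icc_self hp.1)
  rw [iteratedDerivWithin_Icc_eq_of_mem_Ioo hp.1] at h2
  simp only [partialX, h2]

theorem contDiffOn_comp_swap {n : ℕ} {z : ℝ × ℝ → ℝ} {a b c d : ℝ}
    (hz : ContDiffOn ℝ n z (Icc a b ×ˢ Icc c d)) :
    ContDiffOn ℝ n (z ∘ Prod.swap) (Icc c d ×ˢ Icc a b) :=
  hz.comp (contDiff_snd.prodMk contDiff_fst).contDiffOn fun _ hp => ⟨hp.2, hp.1⟩

theorem integrableOn_partialY_sq {n : ℕ} {z : ℝ × ℝ → ℝ} {a b c d : ℝ} (hab : a < b)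
    (hcd : c < d) (hz : ContDiffOn ℝ n z (Icc a b ×ˢ Icc c d)) :
    IntegrableOn (fun p => partialY n z p ^ 2) (Ioo a b ×ˢ Ioo c d) :=
  (integrableOn_partialX_sq hcd hab (contDiffOn_comp_swap hz)).swap

theorem contDiffOn_slice_fst {n : ℕ} {z : ℝ × ℝ → ℝ} {a b c d y : ℝ}
    (hz : ContDiffOn ℝ n z (Icc a b ×ˢ Icc c d)) (hy : y ∈ Icc c d) :
    ContDiffOn ℝ n (fun s => z (s, y)) (Icc a b) :=
  hz.comp (contDiff_id.prodMk contDiff_const).contDiffOn fun _ hs => ⟨hs, hy⟩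

theorem contDiffOn_slice_snd {n : ℕ} {z : ℝ × ℝ → ℝ} {a b c d x : ℝ}
    (hz : ContDiffOn ℝ n z (Icc a b ×ˢ Icc c d)) (hx : x ∈ Icc a b) :
    ContDiffOn ℝ n (fun t => z (x, t)) (Icc c d) :=
  hz.comp (contDiff_const.prodMk contDiff_id).contDiffOn fun _ ht => ⟨hx, ht⟩

theorem continuousOn_slice_fst {z : ℝ × ℝ → ℝ} {a b c d y : ℝ}
    (hz : ContinuousOn z (Icc a b ×ˢ Icc c d)) (hy : y ∈ Icc c d) :
    ContinuousOn (fun s => z (s, y)) (Icc a b) :=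
  hz.comp (by fun_prop) fun _ hs => ⟨hs, hy⟩

theorem continuousOn_slice_snd {z : ℝ × ℝ → ℝ} {a b c d x : ℝ}
    (hz : ContinuousOn z (Icc a b ×ˢ Icc c d)) (hx : x ∈ Icc a b) :
    ContinuousOn (fun t => z (x, t)) (Icc c d) :=
  hz.comp (by fun_prop) fun _ ht => ⟨hx, ht⟩

/-! ### Tensor products of the projectors -/

theorem intervalIntegrable_integral_snd {F : ℝ × ℝ → ℝ} {a b c d : ℝ} (hab : a ≤ b) (hcd : c ≤ d)
    (hF : ContinuousOn F (Icc a b ×ˢ Icc c d)) :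
    IntervalIntegrable (fun s => ∫ t in c..d, F (s, t)) volume a b := by
  have h1 : IntegrableOn F (Ioc a b ×ˢ Ioc c d) :=
    (hF.integrableOn_compact (isCompact_Icc.prod isCompact_Icc)).mono_set
      (prod_mono Ioc_subset_Icc_self Ioc_subset_Icc_self)
  rw [IntegrableOn, Measure.volume_eq_prod, ← Measure.prod_restrict] at h1
  rw [intervalIntegrable_iff_integrableOn_Ioc_of_le hab]
  simp only [intervalIntegral.integral_of_le hcd]
  exact h1.integral_prod_left

theorem intervalIntegrable_radau_slice (k : ℕ) {a b c d e : ℝ} (hab : a < b) (hcd : c < d)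
    (he : e = c ∨ e = d) {z : ℝ × ℝ → ℝ} (hz : ContinuousOn z (Icc a b ×ˢ Icc c d)) (y : ℝ) :
    IntervalIntegrable (fun s => (radau k c d e fun t => z (s, t)).eval y) volume a b := by
  have hec : e ∈ Icc c d := by
    rcases he with rfl | rfl
    · exact left_mem_Icc.2 hcd.le
    · exact right_mem_Icc.2 hcd.le
  obtain ⟨κ, r, h⟩ := exists_radau_kernel k hcd he y
  have h1 : IntervalIntegrable (fun s => (∫ t in c..d, z (s, t) * κ.eval t) + r * z (s, e))
      volume a b :=
    (intervalIntegrable_integral_snd (F := fun p => z p * κ.eval p.2) hab.le hcd.le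
      (hz.mul (κ.continuous.comp continuous_snd).continuousOn)).add
    (((continuousOn_slice_fst hz hec).intervalIntegrable_of_Icc hab.le).const_mul r)
  refine h1.congr fun s hs => ?_
  rw [uIoc_of_le hab.le] at hs
  exact (h _ ((continuousOn_slice_snd hz
    (Ioc_subset_Icc_self hs)).intervalIntegrable_of_Icc hcd.le)).symm

/-- One-dimensional projectors acting in different variables commute on continuous functions: by
the kernel representations this is Fubini's theorem. -/
theorem tensorProj_radau_l2Proj_eq_swap (k : ℕ) {a b c d e : ℝ} (hab : a < b) (hcd : c < d)
    (he : e = a ∨ e = b) {z : ℝ × ℝ → ℝ} (hz : ContinuousOn z (Icc a b ×ˢ Icc c d)) (x y : ℝ) :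
    tensorProj (radau k a b e) (l2Proj k c d) z (x, y) =
      tensorProj (l2Proj k c d) (radau k a b e) (z ∘ Prod.swap) (y, x) := by
  have hea : e ∈ Icc a b := by
    rcases he with rfl | rfl
    · exact left_mem_Icc.2 hab.le
    · exact right_mem_Icc.2 hab.le
  obtain ⟨κ, hκ⟩ := exists_l2Proj_kernel k hcd y
  obtain ⟨ρ, r, hρ⟩ := exists_radau_kernel k hab he x
  have h1 : ∀ s ∈ Icc a b, (l2Proj k c d fun t => z (s, t)).eval y =
      ∫ t in c..d, z (s, t) * κ.eval t := fun s hs =>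
    hκ _ ((continuousOn_slice_snd hz hs).intervalIntegrable_of_Icc hcd.le)
  have h2 : ∀ t ∈ Icc c d, (radau k a b e fun s => z (s, t)).eval x =
      (∫ s in a..b, z (s, t) * ρ.eval s) + r * z (e, t) := fun t ht =>
    hρ _ ((continuousOn_slice_fst hz ht).intervalIntegrable_of_Icc hab.le)
  have hzs : ContinuousOn (z ∘ Prod.swap) (Icc c d ×ˢ Icc a b) :=
    hz.comp continuous_swap.continuousOn fun _ hp => ⟨hp.2, hp.1⟩
  have hzκ : ContinuousOn (fun p : ℝ × ℝ => z p * κ.eval p.2) (Icc a b ×ˢ Icc c d) :=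
    hz.mul (κ.continuous.comp continuous_snd).continuousOn
  have hzρ : ContinuousOn (fun p : ℝ × ℝ => (z ∘ Prod.swap) p * ρ.eval p.2)
      (Icc c d ×ˢ Icc a b) :=
    hzs.mul (ρ.continuous.comp continuous_snd).continuousOn
  have h3 : IntervalIntegrable (fun s => (l2Proj k c d fun t => z (s, t)).eval y) volume a b := by
    refine (intervalIntegrable_integral_snd hab.le hcd.le hzκ).congr fun s hs => ?_
    rw [uIoc_of_le hab.le] at hs
    exact (h1 s (Ioc_subset_Icc_self hs)).symm
  have h4 : tensorProj (radau k a b e) (l2Proj k c d) z (x, y) =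
      (∫ s in a..b, ∫ t in c..d, z (s, t) * κ.eval t * ρ.eval s) +
        r * ∫ t in c..d, z (e, t) * κ.eval t := by
    simp only [tensorProj]
    rw [hρ _ h3, h1 e hea]
    congr 1
    refine intervalIntegral.integral_congr fun s hs => ?_
    rw [uIcc_of_le hab.le] at hs
    simp only [h1 s hs, intervalIntegral.integral_mul_const]
  have h5 : tensorProj (l2Proj k c d) (radau k a b e) (z ∘ Prod.swap) (y, x) =
      (∫ t in c..d, ∫ s in a..b, z (s, t) * κ.eval t * ρ.eval s) +
        r * ∫ t in c..d, z (e, t) * κ.eval t := by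
    simp only [tensorProj]
    rw [hκ _ (intervalIntegrable_radau_slice k hcd hab he hzs x)]
    have h6 : ∫ t in c..d, (radau k a b e fun s => (z ∘ Prod.swap) (t, s)).eval x * κ.eval t =
        ∫ t in c..d, ((∫ s in a..b, z (s, t) * ρ.eval s) * κ.eval t +
          r * (z (e, t) * κ.eval t)) := by
      refine intervalIntegral.integral_congr fun t ht => ?_
      rw [uIcc_of_le hcd.le] at ht
      simp only [Function.comp_apply, Prod.swap_prod_mk, h2 t ht]
      ring
    rw [h6, intervalIntegral.integral_add, intervalIntegral.integral_const_mul]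
    · congr 1
      refine intervalIntegral.integral_congr fun t _ => ?_
      simp only [← intervalIntegral.integral_mul_const]
      refine intervalIntegral.integral_congr fun s _ => ?_
      ring
    · exact (intervalIntegrable_integral_snd hcd.le hab.le hzρ).mul_continuousOn
        κ.continuous.continuousOn
    · exact (((continuousOn_slice_snd hz hea).mul
        κ.continuous.continuousOn).intervalIntegrable_of_Icc hcd.le).const_mul r
  rw [h4, h5, intervalIntegral_intervalIntegral_swap]
  rw [uIoc_of_le hab.le, uIoc_of_le hcd.le]
  have h7 : ContinuousOn (Function.uncurry fun s t => z (s, t) * κ.eval t * ρ.eval s)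
      (Icc a b ×ˢ Icc c d) :=
    hzκ.mul (ρ.continuous.comp continuous_fst).continuousOn
  exact (h7.integrableOn_compact (isCompact_Icc.prod isCompact_Icc)).mono_set
    (prod_mono Ioc_subset_Icc_self Ioc_subset_Icc_self)

/-- The pointwise error of `π ⊗ π^±` on a rectangle. The splitting
`1 - π_x π_y^± = (1 - π_x) + π_x (1 - π_y^±)` puts the `L²`-stable projector outside, so that
`1 - π_y^±` is only needed in `L²` in the variable `x`, where it is bounded slice by slice. -/
theorem exists_trace_error (k : ℕ) :
    ∃ K : ℝ, 0 < K ∧ ∀ a b c d e : ℝ, a < b → c < d → (e = c ∨ e = d) → ∀ z : ℝ × ℝ → ℝ,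
      ContDiffOn ℝ (k + 1 : ℕ) z (Icc a b ×ˢ Icc c d) → ∀ x ∈ Icc a b, ∀ y ∈ Icc c d,
      |z (x, y) - tensorProj (l2Proj k a b) (radau k c d e) z (x, y)| ≤
        K * ((b - a) ^ k * (√(b - a) * √(∫ s in Ioo a b, partialX (k + 1) z (s, y) ^ 2)) +
          (d - c) ^ k * (√(d - c) * l2Norm (Ioo a b ×ˢ Ioo c d) (partialY (k + 1) z)) /
            √(b - a)) := by
  obtain ⟨K₁, hK₁, h₁⟩ := exists_l2Proj_error k
  obtain ⟨K₂, hK₂, h₂⟩ := exists_radau_error k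
  obtain ⟨K₃, hK₃, h₃⟩ := exists_l2Proj_bound k
  refine ⟨K₁ + K₃ * K₂, by positivity, fun a b c d e hab hcd he z hz x hx y hy => ?_⟩
  have hbasub : 0 < b - a := sub_pos.2 hab
  have hdcsub : 0 < d - c := sub_pos.2 hcd
  set w : ℝ → ℝ := fun s => (radau k c d e fun t => z (s, t)).eval y with hw
  have hwi : IntervalIntegrable w volume a b :=
    intervalIntegrable_radau_slice k hab hcd he hz.continuousOn y
  have hzy : ContDiffOn ℝ (k + 1 : ℕ) (fun s => z (s, y)) (Icc a b) := contDiffOn_slice_fst hz hy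
  have hzi : IntervalIntegrable (fun s => z (s, y)) volume a b :=
    hzy.continuousOn.intervalIntegrable_of_Icc hab.le
  have hq := isL2Proj_l2Proj k hab hzi
  have hp := isL2Proj_l2Proj k hab hwi
  have hE1 := h₁ a b hab _ _ hzy hq x hx
  -- the error in the `y`-direction, bounded on each vertical slice
  have hG : ∀ s ∈ Icc a b, |z (s, y) - w s| ≤ K₂ * ((d - c) ^ k *
      (√(d - c) * √(∫ t in Ioo c d, partialY (k + 1) z (s, t) ^ 2))) := fun s hs => by
    have hzs := contDiffOn_slice_snd hz hs
    exact h₂ c d e hcd he _ _ hzs (isRadauProj_radau k hcd he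
      (hzs.continuousOn.intervalIntegrable_of_Icc hcd.le)) y hy
  have hYint := integrableOn_partialY_sq hab hcd hz
  have hYint' := hYint
  rw [IntegrableOn, Measure.volume_eq_prod, ← Measure.prod_restrict] at hYint'
  have hYl := hYint'.integral_prod_left
  have hGsq : ∀ s ∈ Ioo a b, (z (s, y) - w s) ^ 2 ≤ (K₂ * ((d - c) ^ k * √(d - c))) ^ 2 *
      ∫ t in Ioo c d, partialY (k + 1) z (s, t) ^ 2 := fun s hs => by
    have h := pow_le_pow_left₀ (abs_nonneg _) (hG s (Ioo_subset_Icc_self hs)) 2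
    rw [sq_abs] at h
    refine h.trans (le_of_eq ?_)
    have h0 : 0 ≤ ∫ t in Ioo c d, partialY (k + 1) z (s, t) ^ 2 :=
      integral_nonneg fun _ => sq_nonneg _
    nth_rewrite 2 [← Real.sq_sqrt h0]
    ring
  -- `L²` integrability of the slice error comes from the slicewise bound itself
  have hgi : IntegrableOn (fun s => z (s, y) - w s) (Ioo a b) :=
    ((intervalIntegrable_iff_integrableOn_Ioc_of_le hab.le).1 (hzi.sub hwi)).mono_set
      Ioo_subset_Ioc_self
  have hgsq : IntegrableOn (fun s => (z (s, y) - w s) ^ 2) (Ioo a b) := by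
    refine (hYl.const_mul ((K₂ * ((d - c) ^ k * √(d - c))) ^ 2)).mono'
      (hgi.aestronglyMeasurable.pow 2) ?_
    refine (ae_restrict_iff' measurableSet_Ioo).2 (Eventually.of_forall fun s hs => ?_)
    rw [Real.norm_of_nonneg (sq_nonneg _)]
    exact hGsq s hs
  have hgm : MemLp (fun s => z (s, y) - w s) 2 (volume.restrict (Ioo a b)) :=
    (memLp_two_iff_integrable_sq hgi.aestronglyMeasurable).2 hgsq
  have hE2 := (h₃ a b hab _ _ (.sub hzi hwi hq hp)).2 hgm x hx
  have hnorm : √(∫ s in Ioo a b, (z (s, y) - w s) ^ 2) ≤ K₂ * ((d - c) ^ k * (√(d - c) *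
      l2Norm (Ioo a b ×ˢ Ioo c d) (partialY (k + 1) z))) := by
    have h : ∫ s in Ioo a b, (z (s, y) - w s) ^ 2 ≤ (K₂ * ((d - c) ^ k * √(d - c))) ^ 2 *
        ∫ p in Ioo a b ×ˢ Ioo c d, partialY (k + 1) z p ^ 2 := by
      rw [Measure.volume_eq_prod, setIntegral_prod _ hYint, ← integral_const_mul]
      exact setIntegral_mono_on hgsq (hYl.const_mul _) measurableSet_Ioo hGsq
    refine (Real.sqrt_le_sqrt h).trans (le_of_eq ?_)
    rw [Real.sqrt_mul (sq_nonneg _), Real.sqrt_sq (by positivity), l2Norm]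
    ring
  have hsplit : z (x, y) - tensorProj (l2Proj k a b) (radau k c d e) z (x, y) =
      (z (x, y) - (l2Proj k a b fun s => z (s, y)).eval x) +
        ((l2Proj k a b fun s => z (s, y)) - l2Proj k a b w).eval x := by
    simp [tensorProj, hw]
  rw [hsplit]
  have hX : 0 ≤ (b - a) ^ k * (√(b - a) * √(∫ s in Ioo a b, partialX (k + 1) z (s, y) ^ 2)) := by
    positivity
  have hY : 0 ≤ (d - c) ^ k * (√(d - c) * l2Norm (Ioo a b ×ˢ Ioo c d) (partialY (k + 1) z)) /
            √(b - a) := by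
    have : 0 ≤ l2Norm (Ioo a b ×ˢ Ioo c d) (partialY (k + 1) z) := Real.sqrt_nonneg _
    positivity
  have hE2' : |((l2Proj k a b fun s => z (s, y)) - l2Proj k a b w).eval x| ≤ K₃ * K₂ *
      ((d - c) ^ k * (√(d - c) * l2Norm (Ioo a b ×ˢ Ioo c d) (partialY (k + 1) z)) /
            √(b - a)) := by
    have h := mul_le_mul_of_nonneg_left
      (div_le_div_of_nonneg_right hnorm (Real.sqrt_nonneg (b - a))) hK₃.le
    exact (hE2.trans h).trans_eq (by ring)
  refine (abs_add_le _ _).trans ((add_le_add hE1 hE2').trans ?_)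
  rw [mul_add, add_mul K₁, add_mul K₁]
  have h5 : 0 ≤ K₃ * K₂ := by positivity
  have h6 := mul_nonneg h5 hX
  have h7 := mul_nonneg hK₁.le hY
  change K₁ * ((b - a) ^ k * (√(b - a) * √(∫ s in Ioo a b, partialX (k + 1) z (s, y) ^ 2))) +
    _ ≤ _
  linarith

/-! ### The estimate on one edge -/

theorem IsQkOn.exists_polynomial_slice {k : ℕ} {a b c d y : ℝ} {v : ℝ × ℝ → ℝ}
    (hv : IsQkOn k (Ioo a b ×ˢ Ioo c d) v) (hy : y ∈ Ioo c d) :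
    ∃ p ∈ degreeLT ℝ (k + 1), ∀ s ∈ Ioo a b, v (s, y) = p.eval s := by
  obtain ⟨r, hr⟩ := hv
  refine ⟨∑ m ∈ Finset.range (k + 1), C (∑ n ∈ Finset.range (k + 1), r m n * y ^ n) * X ^ m,
    Submodule.sum_mem _ fun m hm => ?_, fun s hs => ?_⟩
  · rw [mem_degreeLT]
    exact (degree_C_mul_X_pow_le _ _).trans_lt (by exact_mod_cast Finset.mem_range.1 hm)
  · rw [hr (s, y) ⟨hs, hy⟩]
    simp only [eval_finsetSum, eval_mul, eval_C, eval_pow, eval_X, Finset.sum_mul]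
    refine Finset.sum_congr rfl fun m _ => Finset.sum_congr rfl fun n _ => ?_
    ring

theorem IsQkOn.integrableOn_sq {k : ℕ} {a b c d : ℝ} {v : ℝ × ℝ → ℝ}
    (hv : IsQkOn k (Ioo a b ×ˢ Ioo c d) v) :
    IntegrableOn (fun p => v p ^ 2) (Ioo a b ×ˢ Ioo c d) := by
  obtain ⟨r, hr⟩ := hv
  have h : Continuous fun p : ℝ × ℝ => (∑ m ∈ Finset.range (k + 1),
      ∑ n ∈ Finset.range (k + 1), r m n * p.1 ^ m * p.2 ^ n) ^ 2 := by fun_prop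
  refine ((h.continuousOn.integrableOn_compact (isCompact_Icc.prod isCompact_Icc)).mono_set
    (prod_mono Ioo_subset_Icc_self Ioo_subset_Icc_self)).congr_fun (fun p hp => ?_)
    (measurableSet_Ioo.prod measurableSet_Ioo)
  simp only [hr p hp]

theorem limUnder_nhdsLT_eq {a b : ℝ} (hab : a < b) {f g : ℝ → ℝ}
    (hg : ContinuousOn g (Icc a b)) (h : ∀ s ∈ Ioo a b, f s = g s) :
    limUnder (𝓝[<] b) f = g b := by
  refine Tendsto.limUnder_eq (Tendsto.congr' (f₁ := g) ?_ ?_)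
  · filter_upwards [Ioo_mem_nhdsLT hab] with s hs using (h s hs).symm
  · refine (hg b (right_mem_Icc.2 hab.le)).mono_left ?_
    rw [← nhdsWithin_Ioo_eq_nhdsLT hab]
    exact nhdsWithin_mono _ Ioo_subset_Icc_self

theorem limUnder_nhdsGT_eq {a b : ℝ} (hab : a < b) {f g : ℝ → ℝ}
    (hg : ContinuousOn g (Icc a b)) (h : ∀ s ∈ Ioo a b, f s = g s) :
    limUnder (𝓝[>] a) f = g a := by
  refine Tendsto.limUnder_eq (Tendsto.congr' (f₁ := g) ?_ ?_)
  · filter_upwards [Ioo_mem_nhdsGT hab] with s hs using (h s hs).symm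
  · refine (hg a (left_mem_Icc.2 hab.le)).mono_left ?_
    rw [← nhdsWithin_Ioo_eq_nhdsGT hab]
    exact nhdsWithin_mono _ Ioo_subset_Icc_self

theorem continuous_tensorProj_fst (P Q : (ℝ → ℝ) → ℝ[X]) (z : ℝ × ℝ → ℝ) (y : ℝ) :
    Continuous fun s => tensorProj P Q z (s, y) :=
  (P fun s => (Q fun t => z (s, t)).eval y).continuous

theorem integrableOn_integral_slice {a b c d : ℝ} {g : ℝ × ℝ → ℝ}
    (hg : IntegrableOn g (Ioo a b ×ˢ Ioo c d)) :
    IntegrableOn (fun y => ∫ s in Ioo a b, g (s, y)) (Ioo c d) ∧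
      ∫ y in Ioo c d, ∫ s in Ioo a b, g (s, y) = ∫ p in Ioo a b ×ˢ Ioo c d, g p := by
  rw [IntegrableOn, Measure.volume_eq_prod, ← Measure.prod_restrict] at hg
  refine ⟨hg.integral_prod_right, ?_⟩
  rw [Measure.volume_eq_prod, ← Measure.prod_restrict]
  exact (integral_prod_symm g hg).symm

/-- Fubini's theorem on the union of two rectangles with a common vertical edge. -/
theorem integral_slice_union {a m b c d : ℝ} {g : ℝ × ℝ → ℝ}
    (h₁ : IntegrableOn g (Ioo a m ×ˢ Ioo c d)) (h₂ : IntegrableOn g (Ioo m b ×ˢ Ioo c d)) :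
    IntegrableOn (fun y => (∫ s in Ioo a m, g (s, y)) + ∫ s in Ioo m b, g (s, y)) (Ioo c d) ∧
      ∫ y in Ioo c d, ((∫ s in Ioo a m, g (s, y)) + ∫ s in Ioo m b, g (s, y)) =
        ∫ p in Ioo a m ×ˢ Ioo c d ∪ Ioo m b ×ˢ Ioo c d, g p := by
  have hi₁ := integrableOn_integral_slice h₁
  have hi₂ := integrableOn_integral_slice h₂
  refine ⟨hi₁.1.add hi₂.1, ?_⟩
  have hdisj : Disjoint (Ioo a m ×ˢ Ioo c d) (Ioo m b ×ˢ Ioo c d) := by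
    rw [Set.disjoint_left]
    rintro p hp hp'
    exact lt_asymm hp.1.2 hp'.1.1
  rw [integral_add hi₁.1 hi₂.1, setIntegral_union hdisj
    (measurableSet_Ioo.prod measurableSet_Ioo) h₁ h₂, hi₁.2, hi₂.2]

theorem memLp_sqrt {s : Set ℝ} {g : ℝ → ℝ} (hg : IntegrableOn g s) (h0 : ∀ y, 0 ≤ g y) :
    MemLp (fun y => √(g y)) 2 (volume.restrict s) := by
  refine (memLp_two_iff_integrable_sq
    (Real.continuous_sqrt.comp_aestronglyMeasurable hg.aestronglyMeasurable)).2 ?_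
  simp only [Real.sq_sqrt (h0 _)]
  exact hg

theorem l2Norm_mono {D D' : Set (ℝ × ℝ)} {f : ℝ × ℝ → ℝ}
    (hf : IntegrableOn (fun p => f p ^ 2) D') (h : D ⊆ D') : l2Norm D f ≤ l2Norm D' f :=
  Real.sqrt_le_sqrt (setIntegral_mono_set hf (Eventually.of_forall fun _ => sq_nonneg _)
    (Eventually.of_forall h))

/-- The Cauchy-Schwarz inequality on the edge, for a dominated integrand; no measurability of `F`
is needed. -/
theorem abs_integral_le_of_abs_le_slices {c d : ℝ} (hcd : c ≤ d) {F SX SV : ℝ → ℝ} {A B : ℝ}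
    (hA : 0 ≤ A) (hB : 0 ≤ B) (hX : IntegrableOn SX (Ioo c d)) (hV : IntegrableOn SV (Ioo c d))
    (hX0 : ∀ y, 0 ≤ SX y) (hV0 : ∀ y, 0 ≤ SV y)
    (hF : ∀ y ∈ Ioo c d, |F y| ≤ (A * √(SX y) + B) * √(SV y)) :
    |∫ y in Ioo c d, F y| ≤
      (A * √(∫ y in Ioo c d, SX y) + √(d - c) * B) * √(∫ y in Ioo c d, SV y) := by
  have hXm := memLp_sqrt hX hX0
  have hVm := memLp_sqrt hV hV0
  have h1m : MemLp (fun _ : ℝ => (1 : ℝ)) 2 (volume.restrict (Ioo c d)) := memLp_const 1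
  have hXV := abs_integral_mul_le_sqrt_mul_sqrt hXm hVm
  have h1V := abs_integral_mul_le_sqrt_mul_sqrt h1m hVm
  simp only [Real.sq_sqrt (hX0 _), Real.sq_sqrt (hV0 _)] at hXV
  simp only [Real.sq_sqrt (hV0 _), one_mul, one_pow, integral_const, measureReal_restrict_apply,
    MeasurableSet.univ, univ_inter, Real.volume_real_Ioo_of_le hcd, smul_eq_mul, mul_one] at h1V
  have hi1 : Integrable (fun y => √(SX y) * √(SV y)) (volume.restrict (Ioo c d)) :=
    hXm.integrable_mul hVm
  have hi2 : Integrable (fun y => √(SV y)) (volume.restrict (Ioo c d)) :=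
    hVm.integrable one_le_two
  have h := norm_integral_le_of_norm_le (μ := volume.restrict (Ioo c d)) (f := F)
    (g := fun y => A * (√(SX y) * √(SV y)) + B * √(SV y))
    ((hi1.const_mul A).add (hi2.const_mul B))
    ((ae_restrict_iff' measurableSet_Ioo).2 (Eventually.of_forall fun y hy =>
      (hF y hy).trans_eq (by ring)))
  rw [integral_add (hi1.const_mul A) (hi2.const_mul B), integral_const_mul,
    integral_const_mul] at h
  refine h.trans ?_
  have h2 := mul_le_mul_of_nonneg_left ((le_abs_self _).trans hXV) hA
  have h3 := mul_le_mul_of_nonneg_left ((le_abs_self _).trans h1V) hB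
  refine (add_le_add h2 h3).trans_eq (by ring)

/-- The estimate on a vertical edge `{m} × (c, d)` between two rectangles of equal width, for any
`R` that agrees with the projection `π ⊗ π^±` of `z` on each of them. -/
theorem exists_edge_bound (k : ℕ) :
    ∃ C : ℝ, 0 < C ∧ ∀ a m b c d e : ℝ, a < m → m < b → m - a = b - m → c < d →
      (e = c ∨ e = d) → ∀ z v R : ℝ × ℝ → ℝ,
      ContDiffOn ℝ (k + 1 : ℕ) z (Icc a m ×ˢ Icc c d) →
      ContDiffOn ℝ (k + 1 : ℕ) z (Icc m b ×ˢ Icc c d) →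
      IsQkOn k (Ioo a m ×ˢ Ioo c d) v → IsQkOn k (Ioo m b ×ˢ Ioo c d) v →
      (∀ p ∈ Ioo a m ×ˢ Ioo c d, R p = tensorProj (l2Proj k a m) (radau k c d e) z p) →
      (∀ p ∈ Ioo m b ×ˢ Ioo c d, R p = tensorProj (l2Proj k m b) (radau k c d e) z p) →
      |∫ y in Ioo c d, avgX (z - R) m y * jumpX v m y| ≤
        C * (m - a)⁻¹ *
          ((m - a) ^ (k + 1) * l2Norm (Ioo a m ×ˢ Ioo c d ∪ Ioo m b ×ˢ Ioo c d)
              (partialX (k + 1) z) +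
            (d - c) ^ (k + 1) * l2Norm (Ioo a m ×ˢ Ioo c d ∪ Ioo m b ×ˢ Ioo c d)
              (partialY (k + 1) z)) *
          l2Norm (Ioo a m ×ˢ Ioo c d ∪ Ioo m b ×ˢ Ioo c d) v := by
  obtain ⟨K, hK, hE⟩ := exists_trace_error k
  obtain ⟨K', hK', hI⟩ := exists_l2Proj_bound k
  refine ⟨2 * K * K', by positivity, fun a m b c d e ham hmb heq hcd he z v R hz₁ hz₂ hv₁ hv₂
    hR₁ hR₂ => ?_⟩
  set D : Set (ℝ × ℝ) := Ioo a m ×ˢ Ioo c d ∪ Ioo m b ×ˢ Ioo c d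
  have hH : 0 < m - a := sub_pos.2 ham
  have hL : 0 < d - c := sub_pos.2 hcd
  obtain ⟨hXi, hXe⟩ := integral_slice_union (integrableOn_partialX_sq ham hcd hz₁)
    (integrableOn_partialX_sq hmb hcd hz₂)
  obtain ⟨hVi, hVe⟩ := integral_slice_union hv₁.integrableOn_sq hv₂.integrableOn_sq
  have hYi : IntegrableOn (fun p => partialY (k + 1) z p ^ 2) D :=
    (integrableOn_partialY_sq ham hcd hz₁).union (integrableOn_partialY_sq hmb hcd hz₂)
  set SX : ℝ → ℝ := fun y => (∫ s in Ioo a m, partialX (k + 1) z (s, y) ^ 2) +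
    ∫ s in Ioo m b, partialX (k + 1) z (s, y) ^ 2
  set SV : ℝ → ℝ := fun y => (∫ s in Ioo a m, v (s, y) ^ 2) + ∫ s in Ioo m b, v (s, y) ^ 2
  have hint0 (f : ℝ → ℝ) (s : Set ℝ) : 0 ≤ ∫ t in s, f t ^ 2 :=
    integral_nonneg fun _ => sq_nonneg _
  have hSX0 : ∀ y, 0 ≤ SX y := fun y => add_nonneg (hint0 _ _) (hint0 _ _)
  have hSV0 : ∀ y, 0 ≤ SV y := fun y => add_nonneg (hint0 _ _) (hint0 _ _)
  have hY0 : 0 ≤ l2Norm D (partialY (k + 1) z) := Real.sqrt_nonneg _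
  set B₀ : ℝ := (d - c) ^ k * (√(d - c) * l2Norm D (partialY (k + 1) z)) / √(m - a) with hB₀
  have hB₀0 : 0 ≤ B₀ := by positivity
  -- the two one-sided traces of the projection error
  have hEbound : ∀ y ∈ Ioo c d, |avgX (z - R) m y| ≤
      K * ((m - a) ^ k * (√(m - a) * √(SX y)) + B₀) := fun y hy => by
    have hyI := Ioo_subset_Icc_self hy
    have hl : limUnder (𝓝[<] m) (fun s => (z - R) (s, y)) =
        z (m, y) - tensorProj (l2Proj k a m) (radau k c d e) z (m, y) :=
      limUnder_nhdsLT_eq ham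
        (g := fun s => z (s, y) - tensorProj (l2Proj k a m) (radau k c d e) z (s, y))
        ((continuousOn_slice_fst hz₁.continuousOn hyI).sub
          (continuous_tensorProj_fst _ _ _ _).continuousOn)
        (fun s hs => by simp only [Pi.sub_apply, hR₁ (s, y) ⟨hs, hy⟩])
    have hr : limUnder (𝓝[>] m) (fun s => (z - R) (s, y)) =
        z (m, y) - tensorProj (l2Proj k m b) (radau k c d e) z (m, y) :=
      limUnder_nhdsGT_eq hmb
        (g := fun s => z (s, y) - tensorProj (l2Proj k m b) (radau k c d e) z (s, y))
        ((continuousOn_slice_fst hz₂.continuousOn hyI).sub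
          (continuous_tensorProj_fst _ _ _ _).continuousOn)
        (fun s hs => by simp only [Pi.sub_apply, hR₂ (s, y) ⟨hs, hy⟩])
    have h1 := hE a m c d e ham hcd he z hz₁ m (right_mem_Icc.2 ham.le) y hyI
    have h2 := hE m b c d e hmb hcd he z hz₂ m (left_mem_Icc.2 hmb.le) y hyI
    rw [← heq] at h2
    have hX1 : √(∫ s in Ioo a m, partialX (k + 1) z (s, y) ^ 2) ≤ √(SX y) :=
      Real.sqrt_le_sqrt (le_add_of_nonneg_right (hint0 _ _))
    have hX2 : √(∫ s in Ioo m b, partialX (k + 1) z (s, y) ^ 2) ≤ √(SX y) :=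
      Real.sqrt_le_sqrt (le_add_of_nonneg_left (hint0 _ _))
    have hY1 : l2Norm (Ioo a m ×ˢ Ioo c d) (partialY (k + 1) z) ≤
        l2Norm D (partialY (k + 1) z) := l2Norm_mono hYi subset_union_left
    have hY2 : l2Norm (Ioo m b ×ˢ Ioo c d) (partialY (k + 1) z) ≤
        l2Norm D (partialY (k + 1) z) := l2Norm_mono hYi subset_union_right
    have h1' := h1.trans (show _ ≤ K * ((m - a) ^ k * (√(m - a) * √(SX y)) + B₀) by
      rw [hB₀]; gcongr)
    have h2' := h2.trans (show _ ≤ K * ((m - a) ^ k * (√(m - a) * √(SX y)) + B₀) by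
      rw [hB₀]; gcongr)
    rw [avgX, hl, hr, abs_div, abs_of_pos (two_pos : (0 : ℝ) < 2), div_le_iff₀ two_pos]
    refine (abs_add_le _ _).trans ?_
    linarith
  -- the inverse inequality for the jump
  have hJbound : ∀ y ∈ Ioo c d, |jumpX v m y| ≤ 2 * (K' * (√(SV y) / √(m - a))) :=
      fun y hy => by
    obtain ⟨p₁, hp₁, hp₁'⟩ := hv₁.exists_polynomial_slice hy
    obtain ⟨p₂, hp₂, hp₂'⟩ := hv₂.exists_polynomial_slice hy
    have hl : limUnder (𝓝[<] m) (fun s => v (s, y)) = p₁.eval m :=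
      limUnder_nhdsLT_eq ham p₁.continuousOn hp₁'
    have hr : limUnder (𝓝[>] m) (fun s => v (s, y)) = p₂.eval m :=
      limUnder_nhdsGT_eq hmb p₂.continuousOn hp₂'
    have h1 := (hI a m ham _ _ (isL2Proj_self hp₁)).2
      (memLp_Ioo_of_continuousOn_Icc p₁.continuousOn) m (right_mem_Icc.2 ham.le)
    have h2 := (hI m b hmb _ _ (isL2Proj_self hp₂)).2
      (memLp_Ioo_of_continuousOn_Icc p₂.continuousOn) m (left_mem_Icc.2 hmb.le)
    rw [← heq] at h2
    have e1 : ∫ s in Ioo a m, p₁.eval s ^ 2 = ∫ s in Ioo a m, v (s, y) ^ 2 :=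
      setIntegral_congr_fun measurableSet_Ioo fun s hs => by simp only [hp₁' s hs]
    have e2 : ∫ s in Ioo m b, p₂.eval s ^ 2 = ∫ s in Ioo m b, v (s, y) ^ 2 :=
      setIntegral_congr_fun measurableSet_Ioo fun s hs => by simp only [hp₂' s hs]
    have hV1 : √(∫ s in Ioo a m, p₁.eval s ^ 2) ≤ √(SV y) :=
      Real.sqrt_le_sqrt (e1.trans_le (le_add_of_nonneg_right (hint0 _ _)))
    have hV2 : √(∫ s in Ioo m b, p₂.eval s ^ 2) ≤ √(SV y) :=
      Real.sqrt_le_sqrt (e2.trans_le (le_add_of_nonneg_left (hint0 _ _)))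
    have h1' := h1.trans (show _ ≤ K' * (√(SV y) / √(m - a)) by gcongr)
    have h2' := h2.trans (show _ ≤ K' * (√(SV y) / √(m - a)) by gcongr)
    rw [jumpX, hl, hr]
    refine (abs_sub _ _).trans ?_
    linarith
  have hs : 0 < √(m - a) := Real.sqrt_pos.2 hH
  have hss : √(m - a) * √(m - a) = m - a := Real.mul_self_sqrt hH.le
  have hdd : √(d - c) * √(d - c) = d - c := Real.mul_self_sqrt hL.le
  have hF : ∀ y ∈ Ioo c d, |avgX (z - R) m y * jumpX v m y| ≤
      (2 * K * K' * (m - a) ^ k * √(SX y) + 2 * K * K' * (B₀ / √(m - a))) * √(SV y) :=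
      fun y hy => by
    rw [abs_mul]
    refine (mul_le_mul (hEbound y hy) (hJbound y hy) (abs_nonneg _) (by positivity)).trans_eq ?_
    field_simp
  have h := abs_integral_le_of_abs_le_slices hcd.le (by positivity) (by positivity) hXi hVi hSX0
    hSV0 hF
  rw [hXe, hVe] at h
  refine h.trans_eq ?_
  change (_ * l2Norm D (partialX (k + 1) z) + _) * l2Norm D v = _
  congr 1
  have e1 : √(d - c) * (2 * K * K' * (B₀ / √(m - a))) = 2 * K * K' *
      ((d - c) ^ k * (√(d - c) * √(d - c)) * l2Norm D (partialY (k + 1) z) /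
        (√(m - a) * √(m - a))) := by
    rw [hB₀]
    field_simp
  rw [e1, hss, hdd]
  field_simp
  ring

/-! ### The Shishkin mesh and the piecewise projectors -/

/-- The formula for the mesh points is strictly increasing in all of `ℕ`, also beyond `N`. -/
theorem shishkinPoint_lt_succ {τ : ℝ} (hτ : 0 < τ) (hτ' : τ ≤ 1 / 4) {N : ℕ} (hN : 4 ≤ N)
    (hdvd : 4 ∣ N) (i : ℕ) : shishkinPoint τ N i < shishkinPoint τ N (i + 1) := by
  obtain ⟨n, rfl⟩ := hdvd
  have hn : 1 ≤ n := by omega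
  have hn0 : (0 : ℝ) < n := by exact_mod_cast hn
  have hstep : ((i + 1 : ℕ) : ℝ) / ((4 * n : ℕ) : ℝ) = (i : ℝ) / ((4 * n : ℕ) : ℝ) +
      1 / (4 * n) := by
    push_cast
    ring
  have hpos : (0 : ℝ) < 1 / (4 * n) := by positivity
  simp only [shishkinPoint, hstep]
  generalize (1 : ℝ) / (4 * n) = δ at hpos
  by_cases h1 : 4 * (i + 1) ≤ 4 * n
  · rw [if_pos (by omega), if_pos h1]
    nlinarith
  by_cases h2 : 4 * i ≤ 4 * n
  · have hi : i = n := by omega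
    subst hi
    rw [if_pos h2, if_neg h1, if_pos (by omega)]
    have : (i : ℝ) / ((4 * i : ℕ) : ℝ) = 1 / 4 := by push_cast; field_simp
    rw [this]
    nlinarith
  by_cases h3 : 4 * (i + 1) ≤ 3 * (4 * n)
  · rw [if_neg h2, if_neg h1, if_pos (by omega), if_pos h3]
    nlinarith
  by_cases h4 : 4 * i ≤ 3 * (4 * n)
  · have hi : i = 3 * n := by omega
    subst hi
    rw [if_neg h2, if_neg h1, if_pos h4, if_neg h3]
    have : ((3 * n : ℕ) : ℝ) / ((4 * n : ℕ) : ℝ) = 3 / 4 := by push_cast; field_simp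
    rw [this]
    nlinarith
  · rw [if_neg h2, if_neg h1, if_neg h4, if_neg h3]
    nlinarith

theorem transitionParam_pos {ε β σ : ℝ} {N : ℕ} (hε : 0 < ε) (hβ : 0 < β) (hσ : 0 < σ)
    (hN : 4 ≤ N) : 0 < transitionParam ε β σ N := by
  have hN' : (1 : ℝ) < N := by exact_mod_cast (by omega : 1 < N)
  have h := Real.log_pos hN'
  rw [transitionParam, lt_min_iff]
  exact ⟨by positivity, by norm_num⟩

theorem eq_of_mem_cell {x : ℕ → ℝ} (hx : StrictMono x) {i j : ℕ} {s : ℝ} (hi : s ∈ cell x i)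
    (hj : s ∈ cell x j) : i = j := by
  by_contra hne
  rcases lt_or_gt_of_ne hne with h | h
  · exact absurd (hi.2.trans_le ((hx.monotone (by omega : i ≤ j - 1)))) (lt_asymm hj.1)
  · exact absurd (hj.2.trans_le ((hx.monotone (by omega : j ≤ i - 1)))) (lt_asymm hi.1)

theorem glue_apply {x : ℕ → ℝ} (hx : StrictMono x) {N i j : ℕ} (hi : i ∈ Finset.Icc 1 N)
    (hj : j ∈ Finset.Icc 1 N) (w : ℕ → ℕ → ℝ × ℝ → ℝ) {p : ℝ × ℝ} (hp : p ∈ elem x i j) :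
    glue x N w p = w i j p := by
  rw [glue, Finset.sum_eq_single i, Finset.sum_eq_single j, indicator_of_mem hp]
  · exact fun j' _ hj' => indicator_of_notMem
      (fun hp' => hj' (eq_of_mem_cell hx hp'.2 hp.2)) _
  · exact fun h => absurd hj h
  · exact fun i' _ hi' => Finset.sum_eq_zero fun j' _ => indicator_of_notMem
      (fun hp' => hi' (eq_of_mem_cell hx hp'.1 hp.1)) _
  · exact fun h => absurd hi h

theorem closure_elem {x : ℕ → ℝ} (hx : StrictMono x) {i j : ℕ} (hi : 1 ≤ i) (hj : 1 ≤ j) :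
    closure (elem x i j) = Icc (x (i - 1)) (x i) ×ˢ Icc (x (j - 1)) (x j) := by
  rw [elem, cell, cell, closure_prod_eq, closure_Ioo (hx (by omega)).ne,
    closure_Ioo (hx (by omega)).ne]

theorem l2Norm_preimage_swap (D : Set (ℝ × ℝ)) (f : ℝ × ℝ → ℝ) :
    l2Norm (Prod.swap ⁻¹' D) (f ∘ Prod.swap) = l2Norm D f := by
  have h : MeasurePreserving (Prod.swap : ℝ × ℝ → ℝ × ℝ) volume volume :=
    Measure.measurePreserving_swap
  rw [l2Norm, l2Norm, ← h.setIntegral_preimage_emb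
    MeasurableEquiv.prodComm.measurableEmbedding (fun p => f p ^ 2)]
  rfl

theorem IsQkOn.comp_swap {k : ℕ} {A B : Set ℝ} {v : ℝ × ℝ → ℝ} (hv : IsQkOn k (A ×ˢ B) v) :
    IsQkOn k (B ×ˢ A) (v ∘ Prod.swap) := by
  obtain ⟨r, hr⟩ := hv
  refine ⟨fun m n => r n m, fun p hp => ?_⟩
  rw [Function.comp_apply, hr p.swap ⟨hp.2, hp.1⟩, Finset.sum_comm]
  refine Finset.sum_congr rfl fun m _ => Finset.sum_congr rfl fun n _ => ?_
  simp only [Prod.fst_swap, Prod.snd_swap]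
  ring

/-- Both choices of sign in `Π_y^±` are instances of `π ⊗ radau`. -/
theorem exists_radau_of_mem_PiY {k N : ℕ} {x : ℕ → ℝ} (hx : StrictMono x) {z R : ℝ × ℝ → ℝ}
    (hR : R ∈ ({PiYPlus k x N z, PiYMinus k x N z} : Set (ℝ × ℝ → ℝ))) {j : ℕ}
    (hj : j ∈ Finset.Icc 1 N) :
    ∃ e, (e = x (j - 1) ∨ e = x j) ∧ ∀ i ∈ Finset.Icc 1 N, ∀ p ∈ elem x i j,
      R p = tensorProj (l2Proj k (x (i - 1)) (x i)) (radau k (x (j - 1)) (x j) e) z p := by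
  rcases hR with rfl | rfl
  · exact ⟨_, Or.inl rfl, fun i hi p hp => glue_apply hx hi hj _ hp⟩
  · exact ⟨_, Or.inr rfl, fun i hi p hp => glue_apply hx hi hj _ hp⟩

/-- Both choices of sign in `Π_x^±` are instances of `radau ⊗ π`. -/
theorem exists_radau_of_mem_PiX {k N : ℕ} {x : ℕ → ℝ} (hx : StrictMono x) {z R : ℝ × ℝ → ℝ}
    (hR : R ∈ ({PiXPlus k x N z, PiXMinus k x N z} : Set (ℝ × ℝ → ℝ))) {i : ℕ}
    (hi : i ∈ Finset.Icc 1 N) :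
    ∃ e, (e = x (i - 1) ∨ e = x i) ∧ ∀ j ∈ Finset.Icc 1 N, ∀ p ∈ elem x i j,
      R p = tensorProj (radau k (x (i - 1)) (x i) e) (l2Proj k (x (j - 1)) (x j)) z p := by
  rcases hR with rfl | rfl
  · exact ⟨_, Or.inl rfl, fun j hj p hp => glue_apply hx hi hj _ hp⟩
  · exact ⟨_, Or.inr rfl, fun j hj p hp => glue_apply hx hi hj _ hp⟩

end LDG

theorem lemma4p3 (k : ℕ) :
    ∃ C : ℝ, 0 < C ∧
      ∀ (ε β σ : ℝ) (N : ℕ), 0 < ε → ε ≤ 1 → 0 < β → 0 < σ → 4 ≤ N → 4 ∣ N →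
      ∀ x : ℕ → ℝ, x = LDG.shishkinPoint (LDG.transitionParam ε β σ N) N →
        -- vertical interior edges: `K_{ij}` and `K_{i+1,j}` belong to the mesh and `h_i = h_{i+1}`
        (∀ i j : ℕ, 1 ≤ i → i + 1 ≤ N → 1 ≤ j → j ≤ N →
          LDG.meshWidth x i = LDG.meshWidth x (i + 1) →
          ∀ z : ℝ × ℝ → ℝ,
            ContDiffOn ℝ (k + 1 : ℕ) z
              (closure (LDG.elem x i j) ∪ closure (LDG.elem x (i + 1) j)) →
            ∀ v ∈ LDG.feSpace k x N,
            ∀ R ∈ ({LDG.PiYPlus k x N z, LDG.PiYMinus k x N z} : Set (ℝ × ℝ → ℝ)),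
              |∫ y in LDG.cell x j, LDG.avgX (z - R) (x i) y * LDG.jumpX v (x i) y| ≤
                C * (LDG.meshWidth x i)⁻¹ *
                  (LDG.meshWidth x i ^ (k + 1) *
                      LDG.l2Norm (LDG.elem x i j ∪ LDG.elem x (i + 1) j)
                        (LDG.partialX (k + 1) z) +
                    LDG.meshWidth x j ^ (k + 1) *
                      LDG.l2Norm (LDG.elem x i j ∪ LDG.elem x (i + 1) j)
                        (LDG.partialY (k + 1) z)) *
                  LDG.l2Norm (LDG.elem x i j ∪ LDG.elem x (i + 1) j) v) ∧
        -- horizontal interior edges: `K_{ij}` and `K_{i,j+1}` belong to the mesh and `h_j = h_{j+1}`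
        (∀ i j : ℕ, 1 ≤ i → i ≤ N → 1 ≤ j → j + 1 ≤ N →
          LDG.meshWidth x j = LDG.meshWidth x (j + 1) →
          ∀ z : ℝ × ℝ → ℝ,
            ContDiffOn ℝ (k + 1 : ℕ) z
              (closure (LDG.elem x i j) ∪ closure (LDG.elem x i (j + 1))) →
            ∀ v ∈ LDG.feSpace k x N,
            ∀ R ∈ ({LDG.PiXPlus k x N z, LDG.PiXMinus k x N z} : Set (ℝ × ℝ → ℝ)),
              |∫ s in LDG.cell x i, LDG.avgY (z - R) s (x j) * LDG.jumpY v s (x j)| ≤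
                C * (LDG.meshWidth x j)⁻¹ *
                  (LDG.meshWidth x i ^ (k + 1) *
                      LDG.l2Norm (LDG.elem x i j ∪ LDG.elem x i (j + 1))
                        (LDG.partialX (k + 1) z) +
                    LDG.meshWidth x j ^ (k + 1) *
                      LDG.l2Norm (LDG.elem x i j ∪ LDG.elem x i (j + 1))
                        (LDG.partialY (k + 1) z)) *
                  LDG.l2Norm (LDG.elem x i j ∪ LDG.elem x i (j + 1)) v) := by
  obtain ⟨C, hC, hedge⟩ := LDG.exists_edge_bound k
  refine ⟨C, hC, fun ε β σ N hε _ hβ hσ hN hdvd x hx => ?_⟩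
  have hmono : StrictMono x := by
    rw [hx]
    exact strictMono_nat_of_lt_succ (LDG.shishkinPoint_lt_succ
      (LDG.transitionParam_pos hε hβ hσ hN) (min_le_right _ _) hN hdvd)
  refine ⟨fun i j hi hiN hj hjN hh z hz v hv R hR => ?_,
    fun i j hi hiN hj hjN hh z hz v hv R hR => ?_⟩
  · have hi' : i ∈ Finset.Icc 1 N := Finset.mem_Icc.2 ⟨hi, by omega⟩
    have hi1 : i + 1 ∈ Finset.Icc 1 N := Finset.mem_Icc.2 ⟨by omega, hiN⟩
    have hj' : j ∈ Finset.Icc 1 N := Finset.mem_Icc.2 ⟨hj, hjN⟩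
    rw [LDG.closure_elem hmono hi hj, LDG.closure_elem hmono (by omega) hj] at hz
    obtain ⟨e, he, hRe⟩ := LDG.exists_radau_of_mem_PiY hmono hR hj'
    exact hedge (x (i - 1)) (x i) (x (i + 1)) (x (j - 1)) (x j) e (hmono (by omega))
      (hmono (by omega)) hh (hmono (by omega)) he z v R (hz.mono subset_union_left)
      (hz.mono subset_union_right) (hv.2 i hi' j hj') (hv.2 (i + 1) hi1 j hj')
      (hRe i hi') (hRe (i + 1) hi1)
  · have hi' : i ∈ Finset.Icc 1 N := Finset.mem_Icc.2 ⟨hi, hiN⟩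
    have hj' : j ∈ Finset.Icc 1 N := Finset.mem_Icc.2 ⟨hj, by omega⟩
    have hj1 : j + 1 ∈ Finset.Icc 1 N := Finset.mem_Icc.2 ⟨by omega, hjN⟩
    have hlt : x (i - 1) < x i := hmono (by omega)
    have hlt₁ : x (j - 1) < x j := hmono (by omega)
    have hlt₂ : x j < x (j + 1) := hmono (by omega)
    rw [LDG.closure_elem hmono hi hj, LDG.closure_elem hmono hi (by omega)] at hz
    have hz₁ := hz.mono subset_union_left
    have hz₂ := hz.mono subset_union_right
    obtain ⟨e, he, hRe⟩ := LDG.exists_radau_of_mem_PiX hmono hR hi'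
    -- the vertical estimate for the functions with exchanged variables
    have h := hedge (x (j - 1)) (x j) (x (j + 1)) (x (i - 1)) (x i) e hlt₁ hlt₂ hh hlt he
      (z ∘ Prod.swap) (v ∘ Prod.swap) (R ∘ Prod.swap) (LDG.contDiffOn_comp_swap hz₁)
      (LDG.contDiffOn_comp_swap hz₂) (hv.2 i hi' j hj').comp_swap
      (hv.2 i hi' (j + 1) hj1).comp_swap
      (fun p hp => (hRe j hj' p.swap ⟨hp.2, hp.1⟩).trans
        (LDG.tensorProj_radau_l2Proj_eq_swap k hlt hlt₁ he hz₁.continuousOn p.2 p.1))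
      (fun p hp => (hRe (j + 1) hj1 p.swap ⟨hp.2, hp.1⟩).trans
        (LDG.tensorProj_radau_l2Proj_eq_swap k hlt hlt₂ he hz₂.continuousOn p.2 p.1))
    have hD : (Ioo (x (j - 1)) (x j) ×ˢ Ioo (x (i - 1)) (x i) ∪
        Ioo (x j) (x (j + 1)) ×ˢ Ioo (x (i - 1)) (x i)) =
        Prod.swap ⁻¹' (LDG.elem x i j ∪ LDG.elem x i (j + 1)) := by
      simp [LDG.elem, LDG.cell, preimage_union, preimage_swap_prod]
    have hX : LDG.partialX (k + 1) (z ∘ Prod.swap) = LDG.partialY (k + 1) z ∘ Prod.swap := rfl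
    have hY : LDG.partialY (k + 1) (z ∘ Prod.swap) = LDG.partialX (k + 1) z ∘ Prod.swap := rfl
    rw [hD, hX, hY, LDG.l2Norm_preimage_swap, LDG.l2Norm_preimage_swap,
      LDG.l2Norm_preimage_swap, add_comm (_ * _)] at h
    exact h
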